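/- Let $\mathcal S\subset\mathbb C\setminus\{0\}$ be a finite alphabet and let $s$ be uniformly distributed on $\mathcal S$, with $\mathbb E|s|^2=1$, $\mathbb E s=0$, $\mathbb E s^2=0$, $\mathcal S=-\mathcal S$, and kurtosis $\kappa=\mathbb E|s-\mathbb E s|^4/(\mathbb E|s-\mathbb E s|^2)^2<2$. Fix $\sigma>0$, $L\ge 1$, pairwise distinct delays $\tau_1,\dots,\tau_L\in\mathbb R$ and nonzero amplitudes $\beta_1,\dots,\beta_L\in\mathbb C$. For $N\ge 1$ let $\mathbf s=(s_1,\dots,s_N)^T$ have i.i.d. entries distributed as $s$, let $\mathbf F_N=\big(N^{-1/2}e^{-2\pi i mn/N}\big)_{m,n=0}^{N-1}$, and let $\mathbf P_\tau=\mathbf F_N^H\operatorname{Diag}\big(e^{-2\pi i n\tau/N}\big)_{n=0}^{N-1}\mathbf F_N$ for $\tau\in\mathbb R$. For a unitary $\mathbf U\in\mathbb C^{N\times N}$ (a waveform), the Fisher information matrix of the observation $\mathbf y\sim\mathcal{CN}(\boldsymbol\mu_{\boldsymbol\theta},\sigma^2\mathbf I_N)$, $\boldsymbol\mu_{\boldsymbol\theta}=\sum_{\ell=1}^L\beta_\ell\mathbf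 P_{\tau_\ell}\mathbf U\mathbf s$, with respect to $\boldsymbol\theta=(\tau_\ell,\operatorname{Re}\beta_\ell,\operatorname{Im}\beta_\ell)_{\ell=1}^L\in\mathbb R^{3L}$ and given $\mathbf s$, is $$\mathbf J(\mathbf U,\mathbf s)=\Big(\tfrac{2}{\sigma^2}\operatorname{Re}\Big\{\Big(\frac{\partial\boldsymbol\mu}{\partial\theta_k}\Big)^H\frac{\partial\boldsymbol\mu}{\partial\theta_\ell}\Big\}\Big)_{k,\ell=1}^{3L}.$$ Let $\bar{\mathbf J}=\mathbb E\,\mathbf J(\mathbf U,\mathbf s)$ and $\mathbf Z=\bar{\mathbf J}^{-1}(\mathbf J-\bar{\mathbf J})$ and, for a fixed $\rho\in(0,1)$, let $\Omega_N(\mathbf U)=\{\mathbf s:\|\mathbf Z\|_2<\rho\}$, where $\|\cdot\|_2$ is the spectral norm. For a unit vector $\mathbf u\in\mathbb C^N$ put $p_k=|(\mathbf F_N\mathbf u)_k|^2$, $f_k=k/N$ ($0\le k\le N-1$), $\bar f=\sum_k f_kp_k$ and $B_{\rm rms}(\mathbf u)=\big(\sum_k|f_k-\bar f|^2p_k\big)^{1/2}$.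 Fix $\alpha>0$ and let $\mathbf U=(\mathbf U_N)_{N}$ be a sequence of unitary $N\times N$ matrices that is $\alpha$-frequency-spread: for all sufficiently large $N$, every column $\mathbf u$ of $\mathbf U_N$ satisfies $B_{\rm rms}(\mathbf u)\ge\alpha$. Then there are $c>0$ and $N_0$, both independent of $N$, such that for all $N\ge N_0$ the events $\Omega_N(\mathbf U_N)$ and $\Omega_N(\mathbf F_N^H)$ have positive probability, the respective matrix $\mathbf J$ is invertible on each of them, and $$\mathbb E\big[\operatorname{Tr}\mathbf J(\mathbf U_N,\mathbf s)^{-1}\,\big|\,\Omega_N(\mathbf U_N)\big]-\mathbb E\big[\operatorname{Tr}\mathbf J(\mathbf F_N^H,\mathbf s)^{-1}\,\big|\,\Omega_N(\mathbf F_N^H)\big]\ \ge\ \frac{c}{N^2}.$$ In particular, OFDM (the waveform $\mathbf F_N^H$) has a strictly lower full Cramér–Rao bound $\operatorname{Tr}(\mathbf J^{-1})$ for joint delay and amplitude estimation than the $\alpha$-frequency-spread waveform, for all sufficiently large $N$. -/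

import Mathlib

open MeasureTheory ProbabilityTheory Filter
open scoped Matrix

noncomputable section

namespace ISAC

/-! Data symbols -/

/-- The law of one symbol: uniform on the (finite) constellation alphabet `S`. -/
def symbolLaw (S : Finset ℂ) : Measure ℂ := uniformOn (S : Set ℂ)

/-- The law of the symbol vector `s`: `N` independent symbols drawn from `S`. -/
def symbolVecLaw (S : Finset ℂ) (N : ℕ) : Measure (Fin N → ℂ) :=
  Measure.pi fun _ => symbolLaw S

/-- Kurtosis `E|s - E s|^4 / (E|s - E s|^2)^2` of the constellation. -/
def kurtosis (S : Finset ℂ) : ℝ :=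
  (∫ z, ‖z - ∫ w, w ∂(symbolLaw S)‖ ^ 4 ∂(symbolLaw S)) /
    (∫ z, ‖z - ∫ w, w ∂(symbolLaw S)‖ ^ 2 ∂(symbolLaw S)) ^ 2

/-- Uniform sub-Gaussian constellations: no zero symbol, unit power, zero mean and zero
pseudo-variance, central symmetry of every ring `{z ∈ S : |z|² = r}` (as `|-z| = |z|`, this says
that `S = -S`), and kurtosis less than `2`. -/
structure IsSubGaussianConstellation (S : Finset ℂ) : Prop where
  zero_notMem : (0 : ℂ) ∉ S
  unit_power : ∫ z, ‖z‖ ^ 2 ∂(symbolLaw S) = 1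
  mean_zero : ∫ z, z ∂(symbolLaw S) = 0
  pseudoVar_zero : ∫ z, z ^ 2 ∂(symbolLaw S) = 0
  central_symm : ∀ z ∈ S, -z ∈ S
  kurtosis_lt : kurtosis S < 2

/-! Waveforms. Indices run from `0` to `N - 1`. -/

/-- The normalized `N`-point DFT matrix. -/
def dft (N : ℕ) : Matrix (Fin N) (Fin N) ℂ :=
  Matrix.of fun m n =>
    (1 / (Real.sqrt N : ℂ)) *
      Complex.exp (-(2 * Real.pi * Complex.I * ((m : ℕ) : ℂ) * ((n : ℕ) : ℂ) / (N : ℂ)))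

/-- The OFDM waveform `F_N^H`. -/
def ofdm (N : ℕ) : Matrix (Fin N) (Fin N) ℂ := (dft N)ᴴ

/-- Discrete power spectrum `p_k = |(F_N u)_k|²`. -/
def powerSpectrum {N : ℕ} (u : Fin N → ℂ) (k : Fin N) : ℝ := ‖(dft N *ᵥ u) k‖ ^ 2

/-- Normalized frequency grid. -/
def freq {N : ℕ} (k : Fin N) : ℝ := ((k : ℕ) : ℝ) / (N : ℝ)

/-- Discrete spectral centroid. -/
def centroid {N : ℕ} (u : Fin N → ℂ) : ℝ := ∑ k, freq k * powerSpectrum u k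

/-- Discrete RMS bandwidth. -/
def rmsBandwidth {N : ℕ} (u : Fin N → ℂ) : ℝ :=
  Real.sqrt (∑ k, |freq k - centroid u| ^ 2 * powerSpectrum u k)

/-- Every column of `U` has RMS bandwidth at least `α`. -/
def IsFreqSpread (α : ℝ) {N : ℕ} (U : Matrix (Fin N) (Fin N) ℂ) : Prop :=
  ∀ n, α ≤ rmsBandwidth fun m => U m n

/-! Observation model -/

/-- The periodic delay operator `P_τ`. -/
def delayOp (N : ℕ) (τ : ℝ) : Matrix (Fin N) (Fin N) ℂ :=
  (dft N)ᴴ *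
    Matrix.diagonal (fun n : Fin N =>
      Complex.exp (-(2 * Real.pi * Complex.I * ((n : ℕ) : ℂ) * (τ : ℂ) / (N : ℂ)))) *
    dft N

/-- Index set of the `3L` real parameters: delays, real parts and imaginary parts of the
amplitudes, in this order. -/
abbrev ParamIdx (L : ℕ) : Type := Fin L ⊕ (Fin L ⊕ Fin L)

/-- The parameter vector `θ = [τ, Re β, Im β]`. -/
def params {L : ℕ} (τ : Fin L → ℝ) (β : Fin L → ℂ) : ParamIdx L → ℝ :=
  Sum.elim τ (Sum.elim (fun l => (β l).re) (fun l => (β l).im))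

/-- The noise-free echo `μ_θ = ∑ β_l P_{τ_l} x` for the transmitted block `x`. -/
def echoMean {L N : ℕ} (x : Fin N → ℂ) (θ : ParamIdx L → ℝ) : Fin N → ℂ :=
  ∑ l : Fin L,
    ((θ (Sum.inr (Sum.inl l)) : ℂ) + (θ (Sum.inr (Sum.inr l)) : ℂ) * Complex.I) •
      (delayOp N (θ (Sum.inl l)) *ᵥ x)

/-- The partial derivative `∂μ_θ / ∂θ_k`, entrywise. -/
def echoMeanPartial {L N : ℕ} (x : Fin N → ℂ) (θ : ParamIdx L → ℝ) (k : ParamIdx L) :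
    Fin N → ℂ :=
  fun n => deriv (fun t : ℝ => echoMean x (Function.update θ k t) n) (θ k)

/-- Fisher information matrix of `y ∼ CN(μ_θ, σ² I)` for the parameter `θ = [τ, Re β, Im β]`,
given the transmitted block `x = U s`:
`J_{k,l} = (2/σ²) Re ((∂μ/∂θ_k)^H (∂μ/∂θ_l))`. -/
def fim (σ : ℝ) {L N : ℕ} (τ : Fin L → ℝ) (β : Fin L → ℂ)
    (U : Matrix (Fin N) (Fin N) ℂ) (s : Fin N → ℂ) : Matrix (ParamIdx L) (ParamIdx L) ℝ :=
  Matrix.of fun k l =>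
    2 / σ ^ 2 *
      (star (echoMeanPartial (U *ᵥ s) (params τ β) k) ⬝ᵥ
        echoMeanPartial (U *ᵥ s) (params τ β) l).re

/-- The expected Fisher information matrix `E(J)`, entrywise. -/
def meanFim (S : Finset ℂ) (σ : ℝ) {L N : ℕ} (τ : Fin L → ℝ) (β : Fin L → ℂ)
    (U : Matrix (Fin N) (Fin N) ℂ) : Matrix (ParamIdx L) (ParamIdx L) ℝ :=
  Matrix.of fun k l => ∫ s, fim σ τ β U s k l ∂(symbolVecLaw S N)

/-- The relative fluctuation `Z = E(J)⁻¹ (J - E(J))`. -/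
def fluct (S : Finset ℂ) (σ : ℝ) {L N : ℕ} (τ : Fin L → ℝ) (β : Fin L → ℂ)
    (U : Matrix (Fin N) (Fin N) ℂ) (s : Fin N → ℂ) : Matrix (ParamIdx L) (ParamIdx L) ℝ :=
  (meanFim S σ τ β U)⁻¹ * (fim σ τ β U s - meanFim S σ τ β U)

/-- The event `Ω_N = {s : ‖Z‖₂ < ρ}` of the waveform `U`, with the spectral norm. -/
def goodEvent (S : Finset ℂ) (σ ρ : ℝ) {L N : ℕ} (τ : Fin L → ℝ) (β : Fin L → ℂ)
    (U : Matrix (Fin N) (Fin N) ℂ) : Set (Fin N → ℂ) :=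
  {s | ‖Matrix.toEuclideanCLM (𝕜 := ℝ) (fluct S σ τ β U s)‖ < ρ}

/-- The full Cramér-Rao bound `Tr(J⁻¹)` for joint delay and amplitude estimation. -/
def fullCRB (σ : ℝ) {L N : ℕ} (τ : Fin L → ℝ) (β : Fin L → ℂ)
    (U : Matrix (Fin N) (Fin N) ℂ) (s : Fin N → ℂ) : ℝ :=
  ((fim σ τ β U s)⁻¹).trace

/-- The conditional expectation `E[Tr(J⁻¹) | Ω_N]`. -/
def condFullCRB (S : Finset ℂ) (σ ρ : ℝ) {L N : ℕ} (τ : Fin L → ℝ) (β : Fin L → ℂ)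
    (U : Matrix (Fin N) (Fin N) ℂ) : ℝ :=
  ∫ s, fullCRB σ τ β U s ∂(cond (symbolVecLaw S N) (goodEvent S σ ρ τ β U))

end ISAC

end

/-!
Write `X = F U s` for the spectrum of the transmitted block. The delay operators are diagonal in
the frequency domain, so the Fisher information is a weighted sum `J = ∑ₙ |Xₙ|² G(n / N)` with a
deterministic matrix density `G` (`infoDensity`, `fim_apply`). For unit-power symbols and unitary
`U` the weights have mean one, hence all waveforms share the mean information matrix
`J₀ = ∑ₙ G(n / N)` (`meanFim_eq_flatFim`). By Riemann sums `J₀ / N` converges to `∫ G` over the unit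
interval, which is positive definite because exponential polynomials with distinct exponents are
linearly independent (`posDef_limitFim`). So `K = J₀⁻¹` is of order `1 / N` from above and below
(`exists_flatFim_inv_bounds`).

With `Z = K (J - J₀)` and `J⁻¹ = (1 + Z)⁻¹ K`, expanding to second order gives
`tr J⁻¹ ≈ tr K - tr (Z K) + tr (Z² K)`. The entries of `J - J₀` are centred quadratic forms in
independent bounded symbols, whose fourth moments are of order `N²`
(`expect_centeredQuad_pow_four_le`, by adding one symbol at a time). Hence `E ‖Z‖⁴ = O(N⁻²)`, the
conditioning event has probability `1 - O(N⁻²)`, and the conditional mean of `tr J⁻¹` is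
`tr K + E tr (Z² K)` up to `O(N ^ (-5/2))` (`exists_condFullCRB_expansion`). The first term does not
depend on the waveform.

The second one is a sum of variances of weighted power spectra `∑ₙ gₙ |Xₙ|²`. Such a variance is
`∑ gₙ² - (2 - κ) ∑ⱼ (∑ₙ pⱼ(n) gₙ)²` with `pⱼ` the power spectrum of the `j`-th column
(`expect_powerFluct_sq`). The weights `pⱼ(n)` are doubly stochastic, and for OFDM they form the
identity matrix, so the difference of the variances of the two waveforms is `2 - κ` times the sum
over `j` of the variances of `g` under `pⱼ` (`sum_sq_sub_eq_sum_variance`). The entries of `G`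
coupling a delay with its own amplitude are linear in the frequency, so each column contributes at
least its squared bandwidth, and the `N` columns together contribute at least a constant times
`N⁻³ * N * α²` (`le_quadTerm_sub_quadTerm_ofdm`), which dominates the error.
-/

noncomputable section

namespace ISAC

open scoped BigOperators Topology

/-! ### Expectations as finite averages -/

section Law

variable {S : Finset ℂ} {N : ℕ}

/-- Integration against a measure carried by a finite set `T` on which all atoms have the same
mass. No measurability of the integrand is needed. -/
theorem integral_eq_smul_sum_of_finite_support {X E : Type*} [MeasurableSpace X]
    [MeasurableSingletonClass X] [NormedAddCommGroup E] [NormedSpace ℝ E] [CompleteSpace E]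
    {μ : Measure X} [IsFiniteMeasure μ] {T : Finset X} (hT : μ (T : Set X)ᶜ = 0) {c : ℝ}
    (hc : ∀ x ∈ T, μ.real {x} = c) (f : X → E) :
    ∫ x, f x ∂μ = c • ∑ x ∈ T, f x := by
  have h : μ.restrict (T : Set X) = μ :=
    Measure.restrict_eq_self_of_ae_mem (mem_ae_iff.2 hT)
  rw [← h, setIntegral_finset T (IntegrableOn.of_finite T.finite_toSet), Finset.smul_sum]
  exact Finset.sum_congr rfl fun x hx => by rw [hc x hx]

theorem isProbabilityMeasure_symbolLaw (hS : S.Nonempty) :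
    IsProbabilityMeasure (symbolLaw S) :=
  isProbabilityMeasure_uniformOn S.finite_toSet hS

theorem isProbabilityMeasure_symbolVecLaw (hS : S.Nonempty) :
    IsProbabilityMeasure (symbolVecLaw S N) := by
  have := isProbabilityMeasure_symbolLaw hS
  unfold symbolVecLaw
  infer_instance

theorem symbolLaw_compl (hS : S.Nonempty) : symbolLaw S (S : Set ℂ)ᶜ = 0 := by
  have := isProbabilityMeasure_symbolLaw hS
  rw [prob_compl_eq_zero_iff S.measurableSet]
  exact uniformOn_self S.finite_toSet hS

theorem symbolLaw_real_singleton {z : ℂ} (hz : z ∈ S) :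
    (symbolLaw S).real {z} = (S.card : ℝ)⁻¹ := by
  classical
  rw [measureReal_def, symbolLaw, ← Finset.coe_singleton, uniformOn_apply_finset,
    Finset.inter_singleton_of_mem hz]
  simp

theorem integral_symbolLaw_eq_sum {E : Type*} [NormedAddCommGroup E] [NormedSpace ℝ E]
    [CompleteSpace E] (hS : S.Nonempty) (f : ℂ → E) :
    ∫ z, f z ∂(symbolLaw S) = (S.card : ℝ)⁻¹ • ∑ z ∈ S, f z := by
  have := isProbabilityMeasure_symbolLaw hS
  exact integral_eq_smul_sum_of_finite_support (symbolLaw_compl hS)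
    (fun _ hz => symbolLaw_real_singleton hz) f

theorem integral_symbolLaw_real (hS : S.Nonempty) (f : ℂ → ℝ) :
    ∫ z, f z ∂(symbolLaw S) = 𝔼 z : S, f z := by
  rw [integral_symbolLaw_eq_sum hS, Fintype.expect_eq_sum_div_card, Finset.sum_coe_sort S f,
    Fintype.card_coe, smul_eq_mul, div_eq_inv_mul]

theorem integral_symbolLaw_complex (hS : S.Nonempty) (f : ℂ → ℂ) :
    ∫ z, f z ∂(symbolLaw S) = 𝔼 z : S, f z := by
  rw [integral_symbolLaw_eq_sum hS, Fintype.expect_eq_sum_div_card, Finset.sum_coe_sort S f,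
    Fintype.card_coe, div_eq_inv_mul, Complex.real_smul]
  simp

/-- The expectation over the random symbol vector is the average over all words in the
alphabet. -/
theorem integral_symbolVecLaw (hS : S.Nonempty) (f : (Fin N → ℂ) → ℝ) :
    ∫ s, f s ∂(symbolVecLaw S N) = 𝔼 s : Fin N → S, f (fun i => s i) := by
  classical
  have := isProbabilityMeasure_symbolLaw hS
  have := isProbabilityMeasure_symbolVecLaw (N := N) hS
  have h0 : symbolVecLaw S N (Fintype.piFinset fun _ : Fin N => S : Set (Fin N → ℂ))ᶜ = 0 := by
    rw [prob_compl_eq_zero_iff (Finset.measurableSet _), Fintype.coe_piFinset, symbolVecLaw,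
      Measure.pi_pi]
    exact Finset.prod_eq_one fun _ _ => uniformOn_self S.finite_toSet hS
  have h1 : ∀ x ∈ (Fintype.piFinset fun _ : Fin N => S),
      (symbolVecLaw S N).real {x} = ((S.card : ℝ)⁻¹) ^ N := by
    intro x hx
    rw [measureReal_def, symbolVecLaw, Measure.pi_singleton, ENNReal.toReal_prod]
    simp_rw [← measureReal_def]
    rw [Finset.prod_congr rfl fun i _ => symbolLaw_real_singleton (Fintype.mem_piFinset.1 hx i)]
    simp
  rw [integral_eq_smul_sum_of_finite_support h0 h1, Fintype.expect_eq_sum_div_card,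
    smul_eq_mul, div_eq_inv_mul]
  congr 1
  · simp
  · refine Finset.sum_bij' (fun s hs i => ⟨s i, Fintype.mem_piFinset.1 hs i⟩)
      (fun s _ i => (s i : ℂ)) ?_ ?_ ?_ ?_ ?_ <;> simp

/-- Averaging over words of length `N + 1` is averaging over the first letter and the rest. -/
theorem expect_cons {T : Type*} [Fintype T] (f : (Fin (N + 1) → T) → ℝ) :
    𝔼 s : Fin (N + 1) → T, f s = 𝔼 s : Fin N → T, 𝔼 z : T, f (Fin.cons z s) := by
  rw [Finset.expect_comm, ← Finset.expect_product (f := fun p => f (Fin.cons p.1 p.2)),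
    Finset.univ_product_univ]
  exact (Fintype.expect_equiv (Fin.consEquiv fun _ => T) _ _ fun p => rfl).symm

/-- The conditional expectation given an event, as a quotient of averages. -/
theorem integral_cond_symbolVecLaw (hS : S.Nonempty) {A : Set (Fin N → ℂ)}
    (hA : MeasurableSet A) (f : (Fin N → ℂ) → ℝ) :
    ∫ s, f s ∂(cond (symbolVecLaw S N) A) =
      ((symbolVecLaw S N).real A)⁻¹ * 𝔼 s : Fin N → S, A.indicator f (fun i => s i) := by
  rw [ProbabilityTheory.cond, integral_smul_measure, ← integral_indicator hA, integral_symbolVecLaw hS,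
    ENNReal.toReal_inv, smul_eq_mul, measureReal_def]

theorem symbolVecLaw_real_eq (hS : S.Nonempty) {A : Set (Fin N → ℂ)} (hA : MeasurableSet A) :
    (symbolVecLaw S N).real A = 𝔼 s : Fin N → S, A.indicator 1 (fun i => (s i : ℂ)) := by
  rw [← integral_symbolVecLaw hS, integral_indicator_one hA]

end Law

/-! ### Moments of one symbol -/

section Moments

variable {S : Finset ℂ}

theorem IsSubGaussianConstellation.nonempty (hS : IsSubGaussianConstellation S) :
    S.Nonempty := by
  rw [Finset.nonempty_iff_ne_empty]
  rintro rfl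
  simpa [symbolLaw] using hS.unit_power

theorem IsSubGaussianConstellation.expect_self (hS : IsSubGaussianConstellation S) :
    𝔼 z : S, (z : ℂ) = 0 := by
  rw [← integral_symbolLaw_complex hS.nonempty (fun z => z), hS.mean_zero]

theorem IsSubGaussianConstellation.expect_sq (hS : IsSubGaussianConstellation S) :
    𝔼 z : S, (z : ℂ) ^ 2 = 0 := by
  rw [← integral_symbolLaw_complex hS.nonempty (fun z => z ^ 2), hS.pseudoVar_zero]

theorem IsSubGaussianConstellation.expect_norm_sq (hS : IsSubGaussianConstellation S) :
    𝔼 z : S, ‖(z : ℂ)‖ ^ 2 = 1 := by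
  rw [← integral_symbolLaw_real hS.nonempty (fun z => ‖z‖ ^ 2), hS.unit_power]

theorem IsSubGaussianConstellation.expect_norm_pow_four (hS : IsSubGaussianConstellation S) :
    𝔼 z : S, ‖(z : ℂ)‖ ^ 4 = kurtosis S := by
  rw [← integral_symbolLaw_real hS.nonempty (fun z => ‖z‖ ^ 4)]
  simp [kurtosis, hS.mean_zero, hS.unit_power]

theorem re_expect {ι : Type*} [Fintype ι] (f : ι → ℂ) : (𝔼 i, f i).re = 𝔼 i, (f i).re := by
  rw [Fintype.expect_eq_sum_div_card, Fintype.expect_eq_sum_div_card, Complex.div_natCast_re,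
    Complex.re_sum]

/-- For deterministic `c`, the real part of `z * c` averages to zero. -/
theorem IsSubGaussianConstellation.expect_re_mul (hS : IsSubGaussianConstellation S) (c : ℂ) :
    𝔼 z : S, ((z : ℂ) * c).re = 0 := by
  have h := congrArg Complex.re (congrArg (· * c) hS.expect_self)
  simp only [zero_mul, Complex.zero_re] at h
  rw [← h, Finset.expect_mul, re_expect]

/-- For deterministic `c`, the square of `Re (z * c)` averages to `|c|² / 2`, because the
pseudo-variance vanishes. -/
theorem IsSubGaussianConstellation.expect_re_mul_sq (hS : IsSubGaussianConstellation S) (c : ℂ) :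
    𝔼 z : S, ((z : ℂ) * c).re ^ 2 = ‖c‖ ^ 2 / 2 := by
  have h : 𝔼 z : S, ((z : ℂ) ^ 2 * c ^ 2).re = 0 := by
    have h := congrArg Complex.re (congrArg (· * c ^ 2) hS.expect_sq)
    simp only [zero_mul, Complex.zero_re] at h
    rw [← h, Finset.expect_mul, re_expect]
  have h2 : ∀ w : ℂ, w.re ^ 2 = ‖w‖ ^ 2 / 2 + (w ^ 2).re / 2 := by
    intro w
    rw [Complex.sq_norm, Complex.normSq_apply, pow_two w, Complex.mul_re]
    ring
  simp_rw [h2, mul_pow, Finset.expect_add_distrib, ← Finset.expect_div, h, norm_mul, mul_pow,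
    ← Finset.expect_mul, hS.expect_norm_sq]
  ring

end Moments

/-! ### Moments of centred quadratic forms in the symbols -/

section Chaos

variable {S : Finset ℂ} {N : ℕ}

theorem expect_word_succ (f : (Fin (N + 1) → ℂ) → ℝ) :
    𝔼 s : Fin (N + 1) → S, f (fun i => s i) =
      𝔼 s : Fin N → S, 𝔼 z : S, f (Fin.cons (z : ℂ) fun i => (s i : ℂ)) := by
  rw [expect_cons]
  refine Finset.expect_congr rfl fun s _ => Finset.expect_congr rfl fun z _ => ?_
  congr 1
  funext i
  refine Fin.cases ?_ (fun j => ?_) i <;> simp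

/-- Increment step for fourth moments: adding to `X` a term `D` with conditional mean zero
increases the fourth moment from order `p²` to order `(p + q)²` if that of `D` has order `q²`. -/
theorem expect_add_pow_four_le {ι κ : Type*} [Fintype ι] [Fintype κ] [Nonempty ι] [Nonempty κ]
    (X : ι → ℝ) (D : ι → κ → ℝ) (hD : ∀ a, 𝔼 t, D a t = 0) {C p q : ℝ}
    (hC : 0 ≤ C) (hp : 0 ≤ p) (hq : 0 ≤ q) (hX : 𝔼 a, X a ^ 4 ≤ 16 * C * p ^ 2)
    (hD4 : 𝔼 a, 𝔼 t, D a t ^ 4 ≤ C * q ^ 2) :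
    𝔼 a, 𝔼 t, (X a + D a t) ^ 4 ≤ 16 * C * (p + q) ^ 2 := by
  have hd : ∀ a, (𝔼 t, D a t ^ 2) ^ 2 ≤ 𝔼 t, D a t ^ 4 := by
    intro a
    have h := Finset.expect_mul_sq_le_sq_mul_sq Finset.univ (fun _ => (1 : ℝ))
      (fun t => D a t ^ 2)
    simpa [← pow_mul] using h
  have hm : 𝔼 a, X a ^ 2 * 𝔼 t, D a t ^ 2 ≤ 4 * C * p * q := by
    refine abs_le_of_sq_le_sq' ?_ (by positivity) |>.2
    calc (𝔼 a, X a ^ 2 * 𝔼 t, D a t ^ 2) ^ 2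
        ≤ (𝔼 a, (X a ^ 2) ^ 2) * 𝔼 a, (𝔼 t, D a t ^ 2) ^ 2 :=
          Finset.expect_mul_sq_le_sq_mul_sq _ _ _
      _ ≤ (16 * C * p ^ 2) * (C * q ^ 2) := by
          refine mul_le_mul ?_ ((Finset.expect_le_expect fun a _ => hd a).trans hD4)
            (Finset.expect_nonneg fun _ _ => sq_nonneg _) (by positivity)
          simpa [← pow_mul] using hX
      _ = (4 * C * p * q) ^ 2 := by ring
  have hpt : ∀ x d : ℝ, (x + d) ^ 4 ≤ x ^ 4 + 4 * x ^ 3 * d + 8 * (x ^ 2 * d ^ 2) + 3 * d ^ 4 := by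
    intro x d
    nlinarith [mul_nonneg (sq_nonneg d) (sq_nonneg (x - d))]
  have hin : ∀ a, 𝔼 t, (X a + D a t) ^ 4 ≤
      X a ^ 4 + 8 * (X a ^ 2 * 𝔼 t, D a t ^ 2) + 3 * 𝔼 t, D a t ^ 4 := by
    intro a
    refine (Finset.expect_le_expect fun t _ => hpt (X a) (D a t)).trans_eq ?_
    simp only [Finset.expect_add_distrib, ← Finset.mul_expect, hD, Fintype.expect_const]
    ring
  refine (Finset.expect_le_expect fun a _ => hin a).trans ?_
  simp only [Finset.expect_add_distrib, ← Finset.mul_expect]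
  nlinarith [mul_nonneg hC (sq_nonneg q), mul_nonneg (mul_nonneg hC hp) hq]

theorem dotProduct_cons (c : Fin (N + 1) → ℂ) (z : ℂ) (s : Fin N → ℂ) :
    c ⬝ᵥ (Fin.cons z s : Fin (N + 1) → ℂ) = z * c 0 + (fun k : Fin N => c k.succ) ⬝ᵥ s := by
  simp [dotProduct, Fin.sum_univ_succ, mul_comm]

theorem expect_re_mul_dotProduct (hS : IsSubGaussianConstellation S) (c : Fin N → ℂ) (w : ℂ) :
    𝔼 s : Fin N → S, (w * (c ⬝ᵥ fun i => (s i : ℂ))).re = 0 := by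
  have := hS.nonempty.to_subtype
  induction N with
  | zero => simp
  | succ N ih =>
    rw [expect_word_succ (fun s => (w * (c ⬝ᵥ s)).re)]
    have h : ∀ (s : Fin N → S) (z : S),
        (w * (c ⬝ᵥ (Fin.cons (z : ℂ) fun i => (s i : ℂ) : Fin (N + 1) → ℂ))).re =
          ((z : ℂ) * (w * c 0)).re +
            (w * ((fun k : Fin N => c k.succ) ⬝ᵥ fun i => (s i : ℂ))).re := by
      intro s z
      rw [dotProduct_cons, ← Complex.add_re]
      ring_nf
    simp only [h, Finset.expect_add_distrib, hS.expect_re_mul, Fintype.expect_const, ih, zero_add]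

theorem expect_norm_dotProduct_sq (hS : IsSubGaussianConstellation S) (c : Fin N → ℂ) :
    𝔼 s : Fin N → S, ‖c ⬝ᵥ fun i => (s i : ℂ)‖ ^ 2 = ∑ k, ‖c k‖ ^ 2 := by
  have := hS.nonempty.to_subtype
  induction N with
  | zero => simp
  | succ N ih =>
    rw [expect_word_succ (fun s => ‖c ⬝ᵥ s‖ ^ 2)]
    have h : ∀ (s : Fin N → S) (z : S),
        ‖c ⬝ᵥ (Fin.cons (z : ℂ) fun i => (s i : ℂ) : Fin (N + 1) → ℂ)‖ ^ 2 =
          ‖(z : ℂ)‖ ^ 2 * ‖c 0‖ ^ 2 + ‖(fun k : Fin N => c k.succ) ⬝ᵥ fun i => (s i : ℂ)‖ ^ 2 +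
            2 * ((z : ℂ) *
              (c 0 * star ((fun k : Fin N => c k.succ) ⬝ᵥ fun i => (s i : ℂ)))).re := by
      intro s z
      rw [dotProduct_cons, ← mul_pow, ← norm_mul]
      simp only [Complex.sq_norm]
      rw [Complex.normSq_add, mul_assoc]
      rfl
    simp only [h, Finset.expect_add_distrib, ← Finset.mul_expect, ← Finset.expect_mul,
      hS.expect_re_mul, Fintype.expect_const, ih, hS.expect_norm_sq]
    simp [Fin.sum_univ_succ]

/-- Khintchine-type bound for the fourth moment of a linear form. -/
theorem expect_re_dotProduct_pow_four_le (hS : IsSubGaussianConstellation S) {M : ℝ}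
    (hM : ∀ z : S, ‖(z : ℂ)‖ ≤ M) (c : Fin N → ℂ) :
    𝔼 s : Fin N → S, (c ⬝ᵥ fun i => (s i : ℂ)).re ^ 4 ≤ 16 * M ^ 4 * (∑ k, ‖c k‖ ^ 2) ^ 2 := by
  have := hS.nonempty.to_subtype
  induction N with
  | zero => simp
  | succ N ih =>
    rw [expect_word_succ (fun s => (c ⬝ᵥ s).re ^ 4), Fin.sum_univ_succ,
      add_comm (‖c 0‖ ^ 2)]
    simp only [dotProduct_cons, Complex.add_re]
    simp only [add_comm (((_ : ℂ) * c 0).re)]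
    refine expect_add_pow_four_le _ _ (fun _ => hS.expect_re_mul _) (by positivity)
      (by positivity) (by positivity) (ih _) ?_
    rw [Fintype.expect_const]
    refine Finset.expect_le Finset.univ_nonempty fun z _ => ?_
    calc ((z : ℂ) * c 0).re ^ 4 = |((z : ℂ) * c 0).re| ^ 4 := ((by decide : Even 4).pow_abs _).symm
      _ ≤ (M * ‖c 0‖) ^ 4 := by
          refine pow_le_pow_left₀ (abs_nonneg _) ((Complex.abs_re_le_norm _).trans ?_) 4
          rw [norm_mul]
          exact mul_le_mul_of_nonneg_right (hM z) (norm_nonneg _)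
      _ = M ^ 4 * (‖c 0‖ ^ 2) ^ 2 := by ring

theorem expect_norm_dotProduct_pow_four_le (hS : IsSubGaussianConstellation S) {M : ℝ}
    (hM : ∀ z : S, ‖(z : ℂ)‖ ≤ M) (c : Fin N → ℂ) :
    𝔼 s : Fin N → S, ‖c ⬝ᵥ fun i => (s i : ℂ)‖ ^ 4 ≤ 64 * M ^ 4 * (∑ k, ‖c k‖ ^ 2) ^ 2 := by
  have h : ∀ w : ℂ, ‖w‖ ^ 4 ≤ 2 * w.re ^ 4 + 2 * (-Complex.I * w).re ^ 4 := by
    intro w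
    have h1 : ‖w‖ ^ 4 = (w.re * w.re + w.im * w.im) ^ 2 := by
      rw [← Complex.normSq_apply, ← Complex.sq_norm]; ring
    have h2 : (-Complex.I * w).re = w.im := by simp
    rw [h1, h2]
    nlinarith [sq_nonneg (w.re ^ 2 - w.im ^ 2)]
  refine (Finset.expect_le_expect fun s _ => h _).trans ?_
  rw [Finset.expect_add_distrib, ← Finset.mul_expect, ← Finset.mul_expect]
  have h1 := expect_re_dotProduct_pow_four_le hS hM c
  have h2 := expect_re_dotProduct_pow_four_le hS hM (-Complex.I • c)
  simp only [smul_dotProduct, smul_eq_mul, Pi.smul_apply, norm_mul, norm_neg, Complex.norm_I,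
    one_mul] at h2
  linarith

/-- The quadratic form `sᴴ A s` of a word `s`, minus the trace of `A`, its mean. -/
def centeredQuad (A : Matrix (Fin N) (Fin N) ℂ) (s : Fin N → ℂ) : ℝ :=
  (star s ⬝ᵥ A *ᵥ s).re - A.trace.re

/-- The squared Frobenius norm. -/
def frobSq (A : Matrix (Fin N) (Fin N) ℂ) : ℝ := ∑ i, ∑ j, ‖A i j‖ ^ 2

theorem frobSq_nonneg (A : Matrix (Fin N) (Fin N) ℂ) : 0 ≤ frobSq A :=
  Finset.sum_nonneg fun _ _ => Finset.sum_nonneg fun _ _ => by positivity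

theorem frobSq_succ {A : Matrix (Fin (N + 1)) (Fin (N + 1)) ℂ} (hA : A.IsHermitian) :
    frobSq A = frobSq (A.submatrix Fin.succ Fin.succ) +
      ((A 0 0).re ^ 2 + 2 * ∑ k : Fin N, ‖A 0 k.succ‖ ^ 2) := by
  have h0 : ‖A 0 0‖ ^ 2 = (A 0 0).re ^ 2 := by
    have h : (A 0 0).im = 0 := Complex.conj_eq_iff_im.1 (hA.apply 0 0)
    rw [Complex.sq_norm, Complex.normSq_apply, h]; ring
  have h1 : ∀ k : Fin N, ‖A k.succ 0‖ = ‖A 0 k.succ‖ := fun k => by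
    rw [← hA.apply, norm_star]
  simp only [frobSq, Fin.sum_univ_succ, Finset.sum_add_distrib, h0, h1, Matrix.submatrix_apply]
  ring

/-- Peeling off the first letter of a word: the quadratic form changes by a diagonal term and by
a term linear in the remaining letters. -/
theorem centeredQuad_cons {A : Matrix (Fin (N + 1)) (Fin (N + 1)) ℂ} (hA : A.IsHermitian)
    (z : ℂ) (s : Fin N → ℂ) :
    centeredQuad A (Fin.cons z s) = centeredQuad (A.submatrix Fin.succ Fin.succ) s +
      ((A 0 0).re * (‖z‖ ^ 2 - 1) +
        2 * (z * star ((fun k : Fin N => A 0 k.succ) ⬝ᵥ s)).re) := by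
  have h0 : (A 0 0).im = 0 := Complex.conj_eq_iff_im.1 (hA.apply 0 0)
  have h1 : ∑ k : Fin N, star (s k) * (A k.succ 0 * z) =
      z * star ((fun k : Fin N => A 0 k.succ) ⬝ᵥ s) := by
    rw [dotProduct, star_sum, Finset.mul_sum]
    refine Finset.sum_congr rfl fun k _ => ?_
    rw [star_mul', hA.apply]
    ring
  have h2 : (star z * ((fun k : Fin N => A 0 k.succ) ⬝ᵥ s)).re =
      (z * star ((fun k : Fin N => A 0 k.succ) ⬝ᵥ s)).re := by
    rw [← Complex.conj_re]
    simp
  have h3 : (star z * (A 0 0 * z)).re = (A 0 0).re * ‖z‖ ^ 2 := by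
    rw [Complex.sq_norm, Complex.normSq_apply]
    simp [h0]
    ring
  have h4 : star (Fin.cons z s : Fin (N + 1) → ℂ) ⬝ᵥ A *ᵥ (Fin.cons z s : Fin (N + 1) → ℂ) =
      star z * (A 0 0 * z) + star z * ((fun k : Fin N => A 0 k.succ) ⬝ᵥ s) +
        (∑ k : Fin N, star (s k) * (A k.succ 0 * z) +
          star s ⬝ᵥ (A.submatrix Fin.succ Fin.succ) *ᵥ s) := by
    simp only [dotProduct, Matrix.mulVec, Fin.sum_univ_succ, Pi.star_apply, Fin.cons_zero,
      Fin.cons_succ, Matrix.submatrix_apply, mul_add, Finset.sum_add_distrib]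
    rw [add_add_add_comm]
  rw [centeredQuad, centeredQuad, h4, h1]
  simp only [Complex.add_re, h2, h3, Matrix.trace, Fin.sum_univ_succ, Matrix.diag_apply,
    Matrix.submatrix_apply]
  ring

theorem expect_centeredQuad_increment (hS : IsSubGaussianConstellation S) (a : ℝ) (w : ℂ) :
    𝔼 z : S, (a * (‖(z : ℂ)‖ ^ 2 - 1) + 2 * ((z : ℂ) * w).re) = 0 := by
  have := hS.nonempty.to_subtype
  simp only [Finset.expect_add_distrib, ← Finset.mul_expect, Finset.expect_sub_distrib,
    hS.expect_re_mul, hS.expect_norm_sq, Fintype.expect_const]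
  ring

theorem expect_centeredQuad (hS : IsSubGaussianConstellation S) {A : Matrix (Fin N) (Fin N) ℂ}
    (hA : A.IsHermitian) : 𝔼 s : Fin N → S, centeredQuad A (fun i => s i) = 0 := by
  have := hS.nonempty.to_subtype
  induction N with
  | zero => simp [centeredQuad, Matrix.trace]
  | succ N ih =>
    rw [expect_word_succ]
    simp only [centeredQuad_cons hA]
    simp only [Finset.expect_add_distrib (Finset.univ : Finset S) (fun _ => centeredQuad _ _),
      expect_centeredQuad_increment hS, Fintype.expect_const, add_zero]
    exact ih (hA.submatrix _)

/-- The variance of a quadratic form. The kurtosis enters through the diagonal only. -/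
theorem expect_centeredQuad_sq (hS : IsSubGaussianConstellation S)
    {A : Matrix (Fin N) (Fin N) ℂ} (hA : A.IsHermitian) :
    𝔼 s : Fin N → S, centeredQuad A (fun i => s i) ^ 2 =
      frobSq A - (2 - kurtosis S) * ∑ i, (A i i).re ^ 2 := by
  have := hS.nonempty.to_subtype
  induction N with
  | zero => simp [centeredQuad, Matrix.trace, frobSq]
  | succ N ih =>
    rw [expect_word_succ (fun s => centeredQuad A s ^ 2), frobSq_succ hA, Fin.sum_univ_succ]
    have h : ∀ (x a : ℝ) (w : ℂ),
        𝔼 z : S, (x + (a * (‖(z : ℂ)‖ ^ 2 - 1) + 2 * ((z : ℂ) * w).re)) ^ 2 =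
          x ^ 2 + a ^ 2 * (kurtosis S - 1) + 2 * ‖w‖ ^ 2 +
            𝔼 z : S, (4 * a * (‖(z : ℂ)‖ ^ 2 - 1)) * ((z : ℂ) * w).re := by
      intro x a w
      have h1 : ∀ z : S, (x + (a * (‖(z : ℂ)‖ ^ 2 - 1) + 2 * ((z : ℂ) * w).re)) ^ 2 =
          x ^ 2 + 2 * x * (a * (‖(z : ℂ)‖ ^ 2 - 1) + 2 * ((z : ℂ) * w).re) +
            a ^ 2 * (‖(z : ℂ)‖ ^ 4 - 2 * ‖(z : ℂ)‖ ^ 2 + 1) + 4 * ((z : ℂ) * w).re ^ 2 +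
            (4 * a * (‖(z : ℂ)‖ ^ 2 - 1)) * ((z : ℂ) * w).re := fun z => by ring
      rw [Finset.expect_congr rfl fun z _ => h1 z]
      simp only [Finset.expect_add_distrib _ (fun z : S => _ + _ + _ + _),
        Finset.expect_add_distrib _ (fun z : S => _ + _ + _),
        ← Finset.mul_expect, hS.expect_re_mul_sq]
      simp only [Finset.expect_add_distrib, Finset.expect_sub_distrib, ← Finset.mul_expect,
        hS.expect_norm_sq, hS.expect_norm_pow_four, hS.expect_re_mul, Fintype.expect_const]
      ring
    -- The mixed term averages to zero over the remaining letters.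
    have h0 : 𝔼 s : Fin N → S, 𝔼 z : S, (4 * (A 0 0).re * (‖(z : ℂ)‖ ^ 2 - 1)) *
        ((z : ℂ) * star ((fun k : Fin N => A 0 k.succ) ⬝ᵥ fun i => (s i : ℂ))).re = 0 := by
      rw [Finset.expect_comm]
      refine Finset.expect_eq_zero fun z _ => ?_
      rw [← Finset.mul_expect]
      have h2 : ∀ w : ℂ, ((z : ℂ) * star w).re = (star (z : ℂ) * w).re := fun w => by
        simp
      simp only [h2, expect_re_mul_dotProduct hS, mul_zero]
    simp only [centeredQuad_cons hA, h, Finset.expect_add_distrib, h0, Fintype.expect_const,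
      ← Finset.mul_expect, norm_star, expect_norm_dotProduct_sq hS, ih (hA.submatrix _)]
    simp only [Matrix.submatrix_apply]
    ring

theorem expect_increment_pow_four_le [Nonempty S] {M : ℝ} (hM1 : 1 ≤ M)
    (hM : ∀ z : S, ‖(z : ℂ)‖ ≤ M) (a : ℝ) (w : ℂ) :
    𝔼 z : S, (a * (‖(z : ℂ)‖ ^ 2 - 1) + 2 * ((z : ℂ) * star w).re) ^ 4 ≤
      128 * M ^ 8 * (a ^ 4 + ‖w‖ ^ 4) := by
  refine Finset.expect_le Finset.univ_nonempty fun z _ => ?_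
  have hz : |‖(z : ℂ)‖ ^ 2 - 1| ≤ 2 * M ^ 2 := by
    have h1 : ‖(z : ℂ)‖ ^ 2 ≤ M ^ 2 := pow_le_pow_left₀ (norm_nonneg _) (hM z) 2
    rw [abs_le]
    constructor <;> nlinarith [sq_nonneg ‖(z : ℂ)‖]
  have hw : |((z : ℂ) * star w).re| ≤ M ^ 2 * ‖w‖ := by
    refine (Complex.abs_re_le_norm _).trans ?_
    rw [norm_mul, norm_star]
    exact mul_le_mul_of_nonneg_right ((hM z).trans (by nlinarith)) (norm_nonneg _)
  have hb : |a * (‖(z : ℂ)‖ ^ 2 - 1) + 2 * ((z : ℂ) * star w).re| ≤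
      2 * M ^ 2 * (|a| + ‖w‖) := by
    refine (abs_add_le _ _).trans ?_
    rw [abs_mul, abs_mul, abs_two]
    nlinarith [abs_nonneg a, mul_le_mul_of_nonneg_left hz (abs_nonneg a)]
  have h4 : (|a| + ‖w‖) ^ 4 ≤ 8 * (a ^ 4 + ‖w‖ ^ 4) := by
    have h := add_pow_le (abs_nonneg a) (norm_nonneg w) 4
    rw [(by decide : Even 4).pow_abs] at h
    norm_num at h ⊢
    linarith
  rw [← (by decide : Even 4).pow_abs]
  calc _ ≤ (2 * M ^ 2 * (|a| + ‖w‖)) ^ 4 := pow_le_pow_left₀ (abs_nonneg _) hb _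
    _ = 16 * M ^ 8 * (|a| + ‖w‖) ^ 4 := by ring
    _ ≤ 16 * M ^ 8 * (8 * (a ^ 4 + ‖w‖ ^ 4)) := by gcongr
    _ = _ := by ring

/-- Fourth moments of quadratic forms are bounded by the fourth power of the Frobenius norm. -/
theorem expect_centeredQuad_pow_four_le (hS : IsSubGaussianConstellation S) {M : ℝ}
    (hM1 : 1 ≤ M) (hM : ∀ z : S, ‖(z : ℂ)‖ ≤ M) {A : Matrix (Fin N) (Fin N) ℂ}
    (hA : A.IsHermitian) :
    𝔼 s : Fin N → S, centeredQuad A (fun i => s i) ^ 4 ≤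
      16 * (2 ^ 13 * M ^ 12) * frobSq A ^ 2 := by
  have := hS.nonempty.to_subtype
  induction N with
  | zero => simp [centeredQuad, Matrix.trace, frobSq]
  | succ N ih =>
    rw [expect_word_succ (fun s => centeredQuad A s ^ 4), frobSq_succ hA]
    simp only [centeredQuad_cons hA]
    refine expect_add_pow_four_le _ _ (fun _ => expect_centeredQuad_increment hS _ _)
      (by positivity) (frobSq_nonneg _) (by positivity) (ih (hA.submatrix _)) ?_
    set a := (A 0 0).re
    set ℓ := ∑ k : Fin N, ‖A 0 k.succ‖ ^ 2 with hℓ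
    have hℓ0 : 0 ≤ ℓ := Finset.sum_nonneg fun _ _ => by positivity
    have hE := Finset.expect_le_expect (s := Finset.univ) fun (s : Fin N → S) _ =>
      expect_increment_pow_four_le hM1 hM a ((fun k : Fin N => A 0 k.succ) ⬝ᵥ fun i => (s i : ℂ))
    refine le_trans hE ?_
    clear hE
    rw [← Finset.mul_expect, Finset.expect_add_distrib, Fintype.expect_const]
    have hL := expect_norm_dotProduct_pow_four_le hS hM (fun k : Fin N => A 0 k.succ)
    have hM4 : 1 ≤ M ^ 4 := one_le_pow₀ hM1
    rw [← hℓ] at hL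
    generalize (𝔼 s : Fin N → S, ‖(fun k : Fin N => A 0 k.succ) ⬝ᵥ fun i => (s i : ℂ)‖ ^ 4) = m
      at hL ⊢
    have ha : 0 ≤ a ^ 4 := by positivity
    have h1 : a ^ 4 + m ≤ 64 * M ^ 4 * (a ^ 2 + 2 * ℓ) ^ 2 := by
      have h2 : a ^ 4 + ℓ ^ 2 ≤ (a ^ 2 + 2 * ℓ) ^ 2 := by
        nlinarith [mul_nonneg (sq_nonneg a) hℓ0, sq_nonneg ℓ]
      nlinarith [mul_nonneg (sub_nonneg.2 hM4) ha, mul_le_mul_of_nonneg_left h2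
        (by positivity : 0 ≤ 64 * M ^ 4)]
    calc 128 * M ^ 8 * (a ^ 4 + m) ≤ 128 * M ^ 8 * (64 * M ^ 4 * (a ^ 2 + 2 * ℓ) ^ 2) :=
          mul_le_mul_of_nonneg_left h1 (by positivity)
      _ = 2 ^ 13 * M ^ 12 * (a ^ 2 + 2 * ℓ) ^ 2 := by ring

end Chaos

/-! ### The discrete Fourier transform -/

section DFT

variable {N : ℕ}

theorem dft_mem_unitaryGroup (N : ℕ) : dft N ∈ Matrix.unitaryGroup (Fin N) ℂ := by
  rw [Matrix.mem_unitaryGroup_iff]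
  rcases Nat.eq_zero_or_pos N with rfl | hN
  · exact Subsingleton.elim _ _
  have hN0 : (N : ℂ) ≠ 0 := by exact_mod_cast hN.ne'
  have hprim := Complex.isPrimitiveRoot_exp N hN.ne'
  set ζ := Complex.exp (2 * Real.pi * Complex.I / N) with hζ
  have hζ0 : ζ ≠ 0 := Complex.exp_ne_zero _
  have hentry : ∀ m n : Fin N, dft N m n = (1 / (Real.sqrt N : ℂ)) * (ζ⁻¹) ^ ((m : ℕ) * n) := by
    intro m n
    rw [dft, Matrix.of_apply, hζ, ← Complex.exp_neg, ← Complex.exp_nat_mul]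
    congr 2
    push_cast
    ring
  have hstar : star ζ = ζ⁻¹ := by
    rw [hζ, ← Complex.exp_neg, Complex.star_def, ← Complex.exp_conj]
    congr 1
    simp [neg_div, map_ofNat]
  have hterm : ∀ m n k : Fin N, dft N m k * star (dft N n k) =
      (1 / (N : ℂ)) * (ζ ^ (n : ℕ) / ζ ^ (m : ℕ)) ^ (k : ℕ) := by
    intro m n k
    have hs : (Real.sqrt N : ℂ) * (Real.sqrt N : ℂ) = N := by
      rw [← Complex.ofReal_mul, Real.mul_self_sqrt (Nat.cast_nonneg N), Complex.ofReal_natCast]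
    have hs0 : (Real.sqrt N : ℂ) ≠ 0 := fun h => hN0 (by rw [← hs, h, zero_mul])
    rw [hentry, hentry, star_mul', star_pow, star_inv₀, hstar, inv_inv, ← hs, div_pow,
      ← pow_mul, ← pow_mul]
    have : star (1 / (Real.sqrt N : ℂ)) = 1 / (Real.sqrt N : ℂ) := by simp
    rw [this, inv_pow]
    field_simp
  ext m n
  rw [Matrix.mul_apply]
  simp only [Matrix.star_apply, hterm, ← Finset.mul_sum]
  rw [Fin.sum_univ_eq_sum_range fun k => (ζ ^ (n : ℕ) / ζ ^ (m : ℕ)) ^ k]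
  rcases eq_or_ne m n with rfl | hmn
  · simp [div_self (pow_ne_zero _ hζ0), hN0]
  · have hne : ζ ^ (n : ℕ) / ζ ^ (m : ℕ) ≠ 1 := by
      rw [Ne, div_eq_one_iff_eq (pow_ne_zero _ hζ0)]
      intro h
      exact hmn (Fin.ext (hprim.pow_inj n.2 m.2 h)).symm
    have hpow : (ζ ^ (n : ℕ) / ζ ^ (m : ℕ)) ^ N = 1 := by
      rw [div_pow, ← pow_mul, ← pow_mul, mul_comm, mul_comm (m : ℕ), pow_mul, pow_mul,
        hprim.pow_eq_one]
      simp
    rw [geom_sum_eq hne, hpow, Matrix.one_apply_ne hmn]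
    simp

theorem ofdm_mem_unitaryGroup (N : ℕ) : ofdm N ∈ Matrix.unitaryGroup (Fin N) ℂ :=
  Unitary.star_mem (dft_mem_unitaryGroup N)

theorem dft_mul_ofdm (N : ℕ) : dft N * ofdm N = 1 :=
  Matrix.mem_unitaryGroup_iff.1 (dft_mem_unitaryGroup N)

end DFT

/-! ### The Fisher information as a weighted sum over frequencies -/

section FIM

variable {L N : ℕ}

/-- The frequency response of the partial derivative of the echo with respect to a parameter, at
normalized frequency `f`. -/
def steer (τ : Fin L → ℝ) (β : Fin L → ℂ) (f : ℝ) : ParamIdx L → ℂ :=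
  Sum.elim
    (fun l => β l * (-(2 * Real.pi * Complex.I * f)) *
      Complex.exp (-(2 * Real.pi * Complex.I * f * τ l)))
    (Sum.elim (fun l => Complex.exp (-(2 * Real.pi * Complex.I * f * τ l)))
      (fun l => Complex.I * Complex.exp (-(2 * Real.pi * Complex.I * f * τ l))))

/-- The Fisher information contributed by unit power at normalized frequency `f`. -/
def infoDensity (σ : ℝ) (τ : Fin L → ℝ) (β : Fin L → ℂ) (f : ℝ) :
    Matrix (ParamIdx L) (ParamIdx L) ℝ :=
  Matrix.of fun k l => 2 / σ ^ 2 * (star (steer τ β f k) * steer τ β f l).re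

/-- The transfer function of the multipath channel with parameter `θ`. -/
def transfer (θ : ParamIdx L → ℝ) (f : ℝ) : ℂ :=
  ∑ l : Fin L, ((θ (Sum.inr (Sum.inl l)) : ℂ) + (θ (Sum.inr (Sum.inr l)) : ℂ) * Complex.I) *
    Complex.exp (-(2 * Real.pi * Complex.I * f * θ (Sum.inl l)))

theorem echoMean_eq (x : Fin N → ℂ) (θ : ParamIdx L → ℝ) (n : Fin N) :
    echoMean x θ n = ∑ k : Fin N, star (dft N k n) * (dft N *ᵥ x) k * transfer θ (freq k) := by
  simp only [echoMean, delayOp, Finset.sum_apply, Pi.smul_apply, smul_eq_mul, transfer,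
    ← Matrix.mulVec_mulVec]
  simp only [Finset.mul_sum]
  rw [Finset.sum_comm]
  refine Finset.sum_congr rfl fun l _ => ?_
  rw [Matrix.mulVec, dotProduct, Finset.mul_sum]
  refine Finset.sum_congr rfl fun k _ => ?_
  rw [Matrix.mulVec_diagonal, Matrix.conjTranspose_apply, freq]
  push_cast
  rw [show (2 * (Real.pi : ℂ) * Complex.I * ((k : ℕ) / N) * (θ (Sum.inl l) : ℂ)) =
    2 * Real.pi * Complex.I * (k : ℕ) * (θ (Sum.inl l) : ℂ) / N by ring]
  ring

theorem hasDerivAt_transfer (τ : Fin L → ℝ) (β : Fin L → ℂ) (f : ℝ) (k : ParamIdx L) :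
    HasDerivAt (fun t : ℝ => transfer (Function.update (params τ β) k t) f) (steer τ β f k)
      (params τ β k) := by
  rcases k with m | m | m
  · have h : ∀ l ∈ Finset.univ, HasDerivAt (fun t : ℝ => β l *
        Complex.exp (-(2 * Real.pi * Complex.I * f * (Function.update τ m t l : ℝ))))
        (if l = m then steer τ β f (Sum.inl m) else 0) (τ m) := by
      intro l _
      split_ifs with hl
      · subst hl
        simp only [Function.update_self]
        have h1 : HasDerivAt (fun t : ℝ => -(2 * Real.pi * Complex.I * f * (t : ℂ)))
            (-(2 * Real.pi * Complex.I * f * 1)) (τ l) :=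
          ((Complex.ofRealCLM.hasDerivAt (x := τ l)).const_mul _).neg
        refine (h1.cexp.const_mul (β l)).congr_deriv ?_
        simp only [steer, Sum.elim_inl]
        ring
      · simp only [Function.update_of_ne hl]
        exact hasDerivAt_const _ _
    refine ((HasDerivAt.fun_sum h).congr_deriv (by simp)).congr_of_eventuallyEq
      (Eventually.of_forall fun t => ?_)
    · show transfer _ _ = _
      simp only [transfer]
      refine Finset.sum_congr rfl fun l _ => ?_
      congr 1
      · simp [params]
      · by_cases hl : l = m
        · subst hl; simp
        · simp [params, Function.update_of_ne hl]
  · have h : ∀ l ∈ Finset.univ, HasDerivAt (fun t : ℝ =>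
        (((Function.update (fun l => (β l).re) m t l : ℝ) : ℂ) + ((β l).im : ℂ) * Complex.I) *
        Complex.exp (-(2 * Real.pi * Complex.I * f * τ l)))
        (if l = m then steer τ β f (Sum.inr (Sum.inl m)) else 0) (β m).re := by
      intro l _
      split_ifs with hl
      · subst hl
        simp only [Function.update_self]
        refine (((Complex.ofRealCLM.hasDerivAt (x := (β l).re)).add_const
          (((β l).im : ℂ) * Complex.I)).mul_const _).congr_deriv ?_
        simp [steer]
      · simp only [Function.update_of_ne hl]
        exact hasDerivAt_const _ _
    refine ((HasDerivAt.fun_sum h).congr_deriv (by simp)).congr_of_eventuallyEq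
      (Eventually.of_forall fun t => ?_)
    · show transfer _ _ = _
      simp only [transfer]
      refine Finset.sum_congr rfl fun l _ => ?_
      by_cases hl : l = m
      · subst hl; simp [params]
      · simp [params, Function.update_of_ne hl]
  · have h : ∀ l ∈ Finset.univ, HasDerivAt (fun t : ℝ =>
        (((β l).re : ℂ) + ((Function.update (fun l => (β l).im) m t l : ℝ) : ℂ) * Complex.I) *
        Complex.exp (-(2 * Real.pi * Complex.I * f * τ l)))
        (if l = m then steer τ β f (Sum.inr (Sum.inr m)) else 0) (β m).im := by
      intro l _
      split_ifs with hl
      · subst hl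
        simp only [Function.update_self]
        refine ((((Complex.ofRealCLM.hasDerivAt (x := (β l).im)).mul_const Complex.I).const_add
          ((β l).re : ℂ)).mul_const _).congr_deriv ?_
        simp [steer]
      · simp only [Function.update_of_ne hl]
        exact hasDerivAt_const _ _
    refine ((HasDerivAt.fun_sum h).congr_deriv (by simp)).congr_of_eventuallyEq
      (Eventually.of_forall fun t => ?_)
    · show transfer _ _ = _
      simp only [transfer]
      refine Finset.sum_congr rfl fun l _ => ?_
      by_cases hl : l = m
      · subst hl; simp [params]
      · simp [params, Function.update_of_ne hl]

theorem echoMeanPartial_eq (x : Fin N → ℂ) (τ : Fin L → ℝ) (β : Fin L → ℂ) (k : ParamIdx L) :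
    echoMeanPartial x (params τ β) k =
      (dft N)ᴴ *ᵥ fun n => (dft N *ᵥ x) n * steer τ β (freq n) k := by
  funext n
  rw [echoMeanPartial]
  simp only [echoMean_eq]
  rw [(HasDerivAt.fun_sum fun j _ => (hasDerivAt_transfer τ β (freq j) k).const_mul
    (star (dft N j n) * (dft N *ᵥ x) j)).deriv]
  simp only [Matrix.mulVec, dotProduct, Matrix.conjTranspose_apply, mul_assoc]

/-- As the delay operators are diagonal in the frequency domain, the information matrix depends on
the transmitted block only through its power spectrum. -/
theorem fim_apply (σ : ℝ) (τ : Fin L → ℝ) (β : Fin L → ℂ) (U : Matrix (Fin N) (Fin N) ℂ)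
    (s : Fin N → ℂ) (k l : ParamIdx L) :
    fim σ τ β U s k l =
      ∑ n, ‖((dft N * U) *ᵥ s) n‖ ^ 2 * infoDensity σ τ β (freq n) k l := by
  have h : ∀ v w : Fin N → ℂ, star ((dft N)ᴴ *ᵥ v) ⬝ᵥ (dft N)ᴴ *ᵥ w = star v ⬝ᵥ w := by
    intro v w
    have h1 : dft N * (dft N)ᴴ = 1 := Matrix.mem_unitaryGroup_iff.1 (dft_mem_unitaryGroup N)
    rw [Matrix.star_mulVec, Matrix.conjTranspose_conjTranspose, ← Matrix.dotProduct_mulVec,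
      Matrix.mulVec_mulVec, h1, Matrix.one_mulVec]
  rw [fim, Matrix.of_apply, echoMeanPartial_eq, echoMeanPartial_eq, h, dotProduct,
    Complex.re_sum, Finset.mul_sum, Matrix.mulVec_mulVec]
  refine Finset.sum_congr rfl fun n _ => ?_
  have h2 : ∀ X a b : ℂ, (star (X * a) * (X * b)).re = ‖X‖ ^ 2 * (star a * b).re := by
    intro X a b
    have : star (X * a) * (X * b) = ((‖X‖ ^ 2 : ℝ) : ℂ) * (star a * b) := by
      rw [star_mul', Complex.sq_norm, ← Complex.mul_conj, Complex.star_def]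
      ring
    rw [this, Complex.re_ofReal_mul]
  rw [Pi.star_apply, h2, infoDensity, Matrix.of_apply]
  ring

end FIM

/-! ### Fluctuations of the power spectrum -/

section Fluct

variable {S : Finset ℂ} {N : ℕ}

/-- The fluctuation `∑ₙ gₙ (|(V s)ₙ|² - 1)` of a weighted power spectrum. -/
def powerFluct (V : Matrix (Fin N) (Fin N) ℂ) (g : Fin N → ℝ) (s : Fin N → ℂ) : ℝ :=
  ∑ n, g n * (‖(V *ᵥ s) n‖ ^ 2 - 1)

/-- The Hermitian matrix `Vᴴ diag(g) V`. -/
def conjDiag (V : Matrix (Fin N) (Fin N) ℂ) (g : Fin N → ℝ) : Matrix (Fin N) (Fin N) ℂ :=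
  Vᴴ * Matrix.diagonal (fun n => (g n : ℂ)) * V

theorem isHermitian_conjDiag (V : Matrix (Fin N) (Fin N) ℂ) (g : Fin N → ℝ) :
    (conjDiag V g).IsHermitian := by
  rw [conjDiag, Matrix.IsHermitian, Matrix.conjTranspose_mul, Matrix.conjTranspose_mul,
    Matrix.conjTranspose_conjTranspose, Matrix.diagonal_conjTranspose, Matrix.mul_assoc]
  congr 3
  funext n
  simp

theorem conjDiag_apply_self_re (V : Matrix (Fin N) (Fin N) ℂ) (g : Fin N → ℝ) (j : Fin N) :
    (conjDiag V g j j).re = ∑ n, ‖V n j‖ ^ 2 * g n := by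
  rw [conjDiag, Matrix.mul_apply, Complex.re_sum]
  refine Finset.sum_congr rfl fun n _ => ?_
  rw [Matrix.mul_diagonal, Matrix.conjTranspose_apply, Complex.sq_norm, Complex.normSq_apply]
  simp
  ring

variable {V : Matrix (Fin N) (Fin N) ℂ}

theorem powerFluct_eq_centeredQuad (hV : V ∈ Matrix.unitaryGroup (Fin N) ℂ) (g : Fin N → ℝ)
    (s : Fin N → ℂ) : powerFluct V g s = centeredQuad (conjDiag V g) s := by
  have h1 : V * Vᴴ = 1 := Matrix.mem_unitaryGroup_iff.1 hV
  rw [centeredQuad, conjDiag, Matrix.trace_mul_comm, ← Matrix.mul_assoc, h1, Matrix.one_mul,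
    ← Matrix.mulVec_mulVec, ← Matrix.mulVec_mulVec, Matrix.dotProduct_mulVec,
    ← Matrix.star_mulVec, dotProduct, Matrix.trace, Complex.re_sum, Complex.re_sum,
    ← Finset.sum_sub_distrib, powerFluct]
  refine Finset.sum_congr rfl fun n _ => ?_
  rw [Matrix.mulVec_diagonal, Pi.star_apply, Matrix.diag_apply, Matrix.diagonal_apply_eq,
    Complex.sq_norm, Complex.normSq_apply]
  simp
  ring

theorem frobSq_eq_trace (A : Matrix (Fin N) (Fin N) ℂ) : frobSq A = (Aᴴ * A).trace.re := by
  rw [frobSq, Finset.sum_comm, Matrix.trace, Complex.re_sum]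
  refine Finset.sum_congr rfl fun j _ => ?_
  rw [Matrix.diag_apply, Matrix.mul_apply, Complex.re_sum]
  refine Finset.sum_congr rfl fun i _ => ?_
  rw [Matrix.conjTranspose_apply, Complex.sq_norm, Complex.normSq_apply]
  simp

theorem frobSq_conjDiag (hV : V ∈ Matrix.unitaryGroup (Fin N) ℂ) (g : Fin N → ℝ) :
    frobSq (conjDiag V g) = ∑ n, g n ^ 2 := by
  have h1 : V * Vᴴ = 1 := Matrix.mem_unitaryGroup_iff.1 hV
  rw [frobSq_eq_trace, (isHermitian_conjDiag V g).eq, conjDiag]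
  have h2 : Vᴴ * Matrix.diagonal (fun n => (g n : ℂ)) * V *
      (Vᴴ * Matrix.diagonal (fun n => (g n : ℂ)) * V) =
      Vᴴ * (Matrix.diagonal (fun n => (g n : ℂ)) * (V * Vᴴ) *
        Matrix.diagonal (fun n => (g n : ℂ))) * V := by
    simp only [Matrix.mul_assoc]
  rw [h2, Matrix.trace_mul_comm, ← Matrix.mul_assoc, h1, Matrix.one_mul, Matrix.mul_one,
    Matrix.diagonal_mul_diagonal, Matrix.trace_diagonal, Complex.re_sum]
  refine Finset.sum_congr rfl fun n _ => ?_
  simp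
  ring

theorem expect_powerFluct (hS : IsSubGaussianConstellation S)
    (hV : V ∈ Matrix.unitaryGroup (Fin N) ℂ) (g : Fin N → ℝ) :
    𝔼 s : Fin N → S, powerFluct V g (fun i => s i) = 0 := by
  simp only [powerFluct_eq_centeredQuad hV]
  exact expect_centeredQuad hS (isHermitian_conjDiag V g)

/-- The variance of a weighted power spectrum: white noise would give `∑ gₙ²`, and the
sub-Gaussian symbols reduce it by the squared means of `g` under the spectra of the columns. -/
theorem expect_powerFluct_sq (hS : IsSubGaussianConstellation S)
    (hV : V ∈ Matrix.unitaryGroup (Fin N) ℂ) (g : Fin N → ℝ) :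
    𝔼 s : Fin N → S, powerFluct V g (fun i => s i) ^ 2 =
      ∑ n, g n ^ 2 - (2 - kurtosis S) * ∑ j, (∑ n, ‖V n j‖ ^ 2 * g n) ^ 2 := by
  simp only [powerFluct_eq_centeredQuad hV]
  rw [expect_centeredQuad_sq hS (isHermitian_conjDiag V g), frobSq_conjDiag hV]
  simp only [conjDiag_apply_self_re]

theorem exists_expect_powerFluct_pow_four_le (hS : IsSubGaussianConstellation S) :
    ∃ C : ℝ, 0 ≤ C ∧ ∀ (N : ℕ) (V : Matrix (Fin N) (Fin N) ℂ),
      V ∈ Matrix.unitaryGroup (Fin N) ℂ → ∀ g : Fin N → ℝ,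
        𝔼 s : Fin N → S, powerFluct V g (fun i => s i) ^ 4 ≤ C * (∑ n, g n ^ 2) ^ 2 := by
  obtain ⟨M, hM⟩ := (Set.finite_range fun z : S => ‖(z : ℂ)‖).bddAbove
  refine ⟨16 * (2 ^ 13 * (max 1 M) ^ 12), by positivity, fun N V hV g => ?_⟩
  simp only [powerFluct_eq_centeredQuad hV]
  rw [← frobSq_conjDiag hV]
  exact expect_centeredQuad_pow_four_le hS (le_max_left _ _)
    (fun z => (hM ⟨z, rfl⟩).trans (le_max_right _ _)) (isHermitian_conjDiag V g)

variable {L : ℕ} (σ : ℝ) (τ : Fin L → ℝ) (β : Fin L → ℂ)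

/-- The total information of a flat unit power spectrum. -/
def flatFim (σ : ℝ) (τ : Fin L → ℝ) (β : Fin L → ℂ) (N : ℕ) :
    Matrix (ParamIdx L) (ParamIdx L) ℝ :=
  ∑ n : Fin N, infoDensity σ τ β (freq n)

/-- All unitary waveforms share the same mean Fisher information. -/
theorem meanFim_eq_flatFim (hS : IsSubGaussianConstellation S) {U : Matrix (Fin N) (Fin N) ℂ}
    (hU : U ∈ Matrix.unitaryGroup (Fin N) ℂ) : meanFim S σ τ β U = flatFim σ τ β N := by
  have := hS.nonempty.to_subtype
  ext k l
  have hV := mul_mem (dft_mem_unitaryGroup N) hU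
  have h : ∀ s : Fin N → ℂ, fim σ τ β U s k l =
      powerFluct (dft N * U) (fun n => infoDensity σ τ β (freq n) k l) s +
        ∑ n : Fin N, infoDensity σ τ β (freq n) k l := by
    intro s
    rw [fim_apply, powerFluct, ← Finset.sum_add_distrib]
    exact Finset.sum_congr rfl fun n _ => by ring
  rw [meanFim, Matrix.of_apply, integral_symbolVecLaw hS.nonempty]
  simp only [h, Finset.expect_add_distrib, expect_powerFluct hS hV, Fintype.expect_const, zero_add,
    flatFim, Matrix.sum_apply]

theorem fim_sub_flatFim_apply (U : Matrix (Fin N) (Fin N) ℂ) (s : Fin N → ℂ)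
    (k l : ParamIdx L) : (fim σ τ β U s - flatFim σ τ β N) k l =
      powerFluct (dft N * U) (fun n => infoDensity σ τ β (freq n) k l) s := by
  rw [Matrix.sub_apply, fim_apply, flatFim, Matrix.sum_apply, powerFluct,
    ← Finset.sum_sub_distrib]
  exact Finset.sum_congr rfl fun n _ => by ring

end Fluct

/-! ### Independence of exponential polynomials of degree one -/

section ExpPoly

open scoped Polynomial

variable {ι : Type*} [Fintype ι]

/-- The exponential polynomial `∑ (zₗ + uₗ t) exp (λₗ t)` vanishes on the unit interval. -/
def ExpPolyVanishes (lam z u : ι → ℂ) : Prop :=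
  ∀ t ∈ Set.Ioo (0 : ℝ) 1, ∑ l, (z l + u l * t) * Complex.exp (lam l * t) = 0

theorem ExpPolyVanishes.deriv {lam z u : ι → ℂ} (h : ExpPolyVanishes lam z u) :
    ExpPolyVanishes lam (fun l => lam l * z l + u l) (fun l => lam l * u l) := by
  intro t ht
  have h1 : HasDerivAt (fun t : ℝ => ∑ l, (z l + u l * t) * Complex.exp (lam l * t))
      (∑ l, ((lam l * z l + u l) + lam l * u l * t) * Complex.exp (lam l * t)) t := by
    refine HasDerivAt.fun_sum fun l _ => ?_
    have ha : HasDerivAt (fun t : ℝ => z l + u l * (t : ℂ)) (u l * 1) t :=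
      ((Complex.ofRealCLM.hasDerivAt (x := t)).const_mul (u l)).const_add _
    have hb : HasDerivAt (fun t : ℝ => lam l * (t : ℂ)) (lam l * 1) t :=
      (Complex.ofRealCLM.hasDerivAt (x := t)).const_mul (lam l)
    refine (ha.mul hb.cexp).congr_deriv ?_
    ring
  have h2 : HasDerivAt (fun t : ℝ => ∑ l, (z l + u l * t) * Complex.exp (lam l * t)) 0 t :=
    (hasDerivAt_const t (0 : ℂ)).congr_of_eventuallyEq
      ((isOpen_Ioo.eventually_mem ht).mono fun s hs => h s hs)
  exact h1.unique h2

/-- Applying the differential operator `p (d/dt)` to a vanishing exponential polynomial. -/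
theorem ExpPolyVanishes.polynomial {lam z u : ι → ℂ} (h : ExpPolyVanishes lam z u) (p : ℂ[X]) :
    ExpPolyVanishes lam (fun l => p.eval (lam l) * z l + p.derivative.eval (lam l) * u l)
      (fun l => p.eval (lam l) * u l) := by
  induction p using Polynomial.induction_on with
  | C a =>
    intro t ht
    rw [← mul_zero a, ← h t ht, Finset.mul_sum]
    refine Finset.sum_congr rfl fun l _ => ?_
    simp
    ring
  | add p q hp hq =>
    intro t ht
    rw [← add_zero (0 : ℂ)]
    nth_rw 1 [← hp t ht]
    rw [← hq t ht, ← Finset.sum_add_distrib]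
    refine Finset.sum_congr rfl fun l _ => ?_
    simp
    ring
  | monomial n a ih =>
    intro t ht
    rw [← ih.deriv t ht]
    refine Finset.sum_congr rfl fun l _ => ?_
    rw [pow_succ, ← mul_assoc, Polynomial.derivative_mul (f := Polynomial.C a * Polynomial.X ^ n)]
    simp only [Polynomial.eval_mul, Polynomial.eval_add, Polynomial.eval_X,
      Polynomial.derivative_X, Polynomial.eval_one]
    ring

/-- Exponential polynomials of degree one with distinct exponents are linearly independent on the
unit interval. -/
theorem ExpPolyVanishes.eq_zero {lam z u : ι → ℂ} (h : ExpPolyVanishes lam z u)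
    (hlam : Function.Injective lam) (m : ι) : z m = 0 ∧ u m = 0 := by
  classical
  -- The operator `q (d/dt)` annihilates every summand except the one with exponent `lam m`.
  set q : ℂ[X] := ∏ j ∈ Finset.univ.erase m, (Polynomial.X - Polynomial.C (lam j)) ^ 2 with hq
  have hqm : q.eval (lam m) ≠ 0 := by
    rw [hq, Polynomial.eval_prod, Finset.prod_ne_zero_iff]
    intro j hj
    simpa using sub_ne_zero.2 fun h => (Finset.ne_of_mem_erase hj) (hlam h).symm
  have hqj : ∀ j, j ≠ m → q.eval (lam j) = 0 ∧ q.derivative.eval (lam j) = 0 := by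
    intro j hj
    obtain ⟨r, hr⟩ := Finset.dvd_prod_of_mem
      (fun j => (Polynomial.X - Polynomial.C (lam j)) ^ 2)
      (Finset.mem_erase.2 ⟨hj, Finset.mem_univ j⟩)
    rw [← hq] at hr
    rw [hr]
    simp [Polynomial.derivative_mul, Polynomial.derivative_pow]
  have hm : ∀ t ∈ Set.Ioo (0 : ℝ) 1, q.eval (lam m) * z m + q.derivative.eval (lam m) * u m +
      q.eval (lam m) * u m * t = 0 := by
    intro t ht
    have h1 := h.polynomial q t ht
    rw [Finset.sum_eq_single m (fun j _ hj => by simp [hqj j hj]) (by simp)] at h1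
    exact (mul_eq_zero.1 h1).resolve_right (Complex.exp_ne_zero _)
  have h1 := hm (1 / 2) ⟨by norm_num, by norm_num⟩
  have h2 := hm (1 / 4) ⟨by norm_num, by norm_num⟩
  push_cast at h1 h2
  have hu : u m = 0 := by
    have : q.eval (lam m) * u m = 0 := by linear_combination 4 * h1 - 4 * h2
    exact (mul_eq_zero.1 this).resolve_left hqm
  refine ⟨?_, hu⟩
  rw [hu] at h1
  exact (mul_eq_zero.1 (by linear_combination h1 : q.eval (lam m) * z m = 0)).resolve_left hqm

end ExpPoly

/-! ### Riemann sums and the limiting information matrix -/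

theorem tendsto_riemann_sum {f : ℝ → ℝ} (hf : Continuous f) :
    Tendsto (fun N : ℕ => (∑ n : Fin N, f (freq n)) / N) atTop (𝓝 (∫ t in (0 : ℝ)..1, f t)) := by
  have huc : UniformContinuousOn f (Set.Icc 0 1) :=
    isCompact_Icc.uniformContinuousOn_of_continuous hf.continuousOn
  rw [Metric.tendsto_atTop]
  intro ε hε
  obtain ⟨δ, hδ, h⟩ := Metric.uniformContinuousOn_iff.1 huc (ε / 2) (half_pos hε)
  obtain ⟨N₀, hN₀⟩ := exists_nat_gt (1 / δ)
  refine ⟨N₀ + 1, fun N hN => ?_⟩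
  have hNpos : (0 : ℝ) < N := by exact_mod_cast (by omega : 0 < N)
  have hNδ : 1 / (N : ℝ) < δ := by
    rw [div_lt_comm₀ hNpos hδ]
    exact hN₀.trans_le (by exact_mod_cast (by omega : N₀ ≤ N))
  have hsplit : ∫ t in (0 : ℝ)..1, f t =
      ∑ n : Fin N, ∫ t in ((n : ℕ) : ℝ) / N..((n + 1 : ℕ) : ℝ) / N, f t := by
    rw [Fin.sum_univ_eq_sum_range fun n => ∫ t in (n : ℝ) / N..((n + 1 : ℕ) : ℝ) / N, f t]
    rw [intervalIntegral.sum_integral_adjacent_intervals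
      (a := fun n : ℕ => (n : ℝ) / N) fun k _ => hf.intervalIntegrable _ _]
    simp [hNpos.ne']
  have hpiece : ∀ n : Fin N, |f (freq n) / N -
      ∫ t in ((n : ℕ) : ℝ) / N..((n + 1 : ℕ) : ℝ) / N, f t| ≤ ε / 2 / N := by
    intro n
    have hlen : ((n + 1 : ℕ) : ℝ) / N - ((n : ℕ) : ℝ) / N = 1 / N := by push_cast; ring
    have hle : ((n : ℕ) : ℝ) / N ≤ ((n + 1 : ℕ) : ℝ) / N := by
      have : 0 < 1 / (N : ℝ) := by positivity
      linarith
    have hconst : f (freq n) / N =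
        ∫ _ in ((n : ℕ) : ℝ) / N..((n + 1 : ℕ) : ℝ) / N, f (freq n) := by
      rw [intervalIntegral.integral_const, hlen, smul_eq_mul]
      ring
    rw [hconst, ← intervalIntegral.integral_sub (by simp) (hf.intervalIntegrable _ _)]
    have hb := intervalIntegral.norm_integral_le_of_norm_le_const
      (a := ((n : ℕ) : ℝ) / N) (b := ((n + 1 : ℕ) : ℝ) / N) (C := ε / 2)
      (f := fun t => f (freq n) - f t) ?_
    · rw [hlen, abs_of_pos (by positivity), Real.norm_eq_abs] at hb
      exact hb.trans_eq (by ring)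
    · intro t ht
      rw [Set.uIoc_of_le hle] at ht
      have hn1 : ((n + 1 : ℕ) : ℝ) / N ≤ 1 := by
        rw [div_le_one hNpos]
        exact_mod_cast n.2
      have hn0 : 0 ≤ ((n : ℕ) : ℝ) / N := by positivity
      refine (h _ ⟨hn0, hle.trans hn1⟩ _ ⟨hn0.trans ht.1.le, ht.2.trans hn1⟩ ?_).le
      rw [Real.dist_eq, abs_sub_comm, abs_of_nonneg (sub_nonneg.2 ht.1.le)]
      linarith [ht.2]
  rw [Real.dist_eq, hsplit, Finset.sum_div, ← Finset.sum_sub_distrib]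
  calc _ ≤ ∑ n : Fin N, |f (freq n) / N -
        ∫ t in ((n : ℕ) : ℝ) / N..((n + 1 : ℕ) : ℝ) / N, f t| := Finset.abs_sum_le_sum_abs _ _
    _ ≤ ∑ _n : Fin N, ε / 2 / N := Finset.sum_le_sum fun n _ => hpiece n
    _ = ε / 2 := by
        simp only [Finset.sum_const, Finset.card_univ, Fintype.card_fin, nsmul_eq_mul]
        field_simp
    _ < ε := half_lt_self hε

section LimitFim

variable {L : ℕ} (σ : ℝ) (τ : Fin L → ℝ) (β : Fin L → ℂ)

theorem continuous_steer (k : ParamIdx L) : Continuous fun f => steer τ β f k := by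
  rcases k with l | l | l <;> simp only [steer, Sum.elim_inl, Sum.elim_inr] <;> fun_prop

theorem continuous_infoDensity (k l : ParamIdx L) :
    Continuous fun f => infoDensity σ τ β f k l := by
  simp only [infoDensity, Matrix.of_apply]
  exact continuous_const.mul (Complex.continuous_re.comp
    ((continuous_steer τ β k).star.mul (continuous_steer τ β l)))

/-- The limit of the flat information matrix per frequency bin. -/
def limitFim : Matrix (ParamIdx L) (ParamIdx L) ℝ :=
  Matrix.of fun k l => ∫ f in (0 : ℝ)..1, infoDensity σ τ β f k l

theorem tendsto_flatFim :
    Tendsto (fun N : ℕ => (N : ℝ)⁻¹ • flatFim σ τ β N) atTop (𝓝 (limitFim σ τ β)) := by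
  refine tendsto_pi_nhds.2 fun k => tendsto_pi_nhds.2 fun l => ?_
  refine (tendsto_riemann_sum (continuous_infoDensity σ τ β k l)).congr fun N => ?_
  rw [Matrix.smul_apply, flatFim, Matrix.sum_apply, smul_eq_mul, div_eq_inv_mul]

theorem infoDensity_comm (f : ℝ) (k l : ParamIdx L) :
    infoDensity σ τ β f k l = infoDensity σ τ β f l k := by
  simp only [infoDensity, Matrix.of_apply]
  rw [← Complex.conj_re]
  simp [mul_comm]

/-- The quadratic form of the information density is a squared modulus. -/
theorem dotProduct_infoDensity_mulVec (f : ℝ) (x : ParamIdx L → ℝ) :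
    x ⬝ᵥ infoDensity σ τ β f *ᵥ x = 2 / σ ^ 2 * ‖∑ k, (x k : ℂ) * steer τ β f k‖ ^ 2 := by
  have h : ((‖∑ k, (x k : ℂ) * steer τ β f k‖ ^ 2 : ℝ) : ℂ) =
      ∑ k, ∑ l, ((x k * x l : ℝ) : ℂ) * (star (steer τ β f k) * steer τ β f l) := by
    rw [Complex.sq_norm, ← Complex.mul_conj, map_sum, Finset.sum_mul_sum, Finset.sum_comm]
    refine Finset.sum_congr rfl fun k _ => Finset.sum_congr rfl fun l _ => ?_
    simp
    ring
  have h' := congrArg Complex.re h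
  simp only [Complex.ofReal_re, Complex.re_sum, Complex.re_ofReal_mul] at h'
  rw [h', dotProduct, Finset.mul_sum]
  refine Finset.sum_congr rfl fun k _ => ?_
  rw [Matrix.mulVec, dotProduct, Finset.mul_sum, Finset.mul_sum]
  refine Finset.sum_congr rfl fun l _ => ?_
  rw [infoDensity, Matrix.of_apply]
  ring

theorem posDef_limitFim (hσ : 0 < σ) (hτ : Function.Injective τ) (hβ : ∀ l, β l ≠ 0) :
    (limitFim σ τ β).PosDef := by
  refine Matrix.PosDef.of_dotProduct_mulVec_pos ?_ fun x hx => ?_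
  · ext k l
    simp only [Matrix.conjTranspose_apply, limitFim, Matrix.of_apply, star_trivial]
    exact intervalIntegral.integral_congr fun f _ => infoDensity_comm σ τ β f l k
  have hcont : Continuous fun f => ∑ k, (x k : ℂ) * steer τ β f k :=
    continuous_finsetSum _ fun k _ => continuous_const.mul (continuous_steer τ β k)
  have hint : star x ⬝ᵥ limitFim σ τ β *ᵥ x =
      ∫ f in (0 : ℝ)..1, 2 / σ ^ 2 * ‖∑ k, (x k : ℂ) * steer τ β f k‖ ^ 2 := by
    simp only [← dotProduct_infoDensity_mulVec, dotProduct, Matrix.mulVec, limitFim,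
      Matrix.of_apply, star_trivial]
    have hc : ∀ k l, IntervalIntegrable (fun f => x k * (infoDensity σ τ β f k l * x l))
        volume 0 1 := fun k l => (continuous_const.mul
      ((continuous_infoDensity σ τ β k l).mul continuous_const)).intervalIntegrable _ _
    simp only [Finset.mul_sum]
    rw [intervalIntegral.integral_finsetSum fun k _ => ?_]
    · refine Finset.sum_congr rfl fun k _ => ?_
      rw [intervalIntegral.integral_finsetSum fun l _ => hc k l]
      simp only [intervalIntegral.integral_mul_const, intervalIntegral.integral_const_mul]
    · exact (continuous_finsetSum _ fun l _ => continuous_const.mul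
        ((continuous_infoDensity σ τ β k l).mul continuous_const)).intervalIntegrable _ _
  rw [hint]
  by_contra hneg
  apply hx
  have hvan : ExpPolyVanishes (fun l => -(2 * Real.pi * Complex.I * τ l))
      (fun l => (x (Sum.inr (Sum.inl l)) : ℂ) + x (Sum.inr (Sum.inr l)) * Complex.I)
      (fun l => (x (Sum.inl l) : ℂ) * (β l * -(2 * Real.pi * Complex.I))) := by
    intro t ht
    by_contra hne
    apply hneg
    refine intervalIntegral.integral_pos one_pos
      (continuous_const.mul (hcont.norm.pow 2)).continuousOn (fun f _ => by positivity)
      ⟨t, Set.Ioo_subset_Icc_self ht, ?_⟩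
    have : ∑ k, (x k : ℂ) * steer τ β t k ≠ 0 := by
      convert hne using 1
      rw [Fintype.sum_sum_type, Fintype.sum_sum_type, ← Finset.sum_add_distrib,
        ← Finset.sum_add_distrib]
      refine Finset.sum_congr rfl fun l _ => ?_
      simp only [steer, Sum.elim_inl, Sum.elim_inr]
      rw [show -(2 * (Real.pi : ℂ) * Complex.I * t * τ l) =
        -(2 * Real.pi * Complex.I * τ l) * t by ring]
      ring
    positivity
  have hpi : (2 * (Real.pi : ℂ) * Complex.I) ≠ 0 := by simp [Real.pi_ne_zero]
  have hz := hvan.eq_zero fun k l h => hτ (by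
    exact_mod_cast mul_left_cancel₀ hpi (neg_injective h))
  funext k
  rcases k with l | l | l
  · have h := (hz l).2
    simpa [hβ l, Real.pi_ne_zero] using h
  · simpa using congrArg Complex.re (hz l).1
  · simpa using congrArg Complex.im (hz l).1

end LimitFim

/-! ### Two-sided bounds for the mean information matrix and its inverse -/

section Bounds

open scoped Matrix.Norms.L2Operator

variable {ι : Type*} [Fintype ι]

theorem norm_toLp_sq (x : ι → ℝ) : ‖WithLp.toLp 2 x‖ ^ 2 = x ⬝ᵥ x := by
  rw [EuclideanSpace.real_norm_sq_eq, dotProduct]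
  exact Finset.sum_congr rfl fun i _ => pow_two _

theorem dotProduct_self_nonneg_real (x : ι → ℝ) : 0 ≤ x ⬝ᵥ x := by
  rw [← norm_toLp_sq]; positivity

theorem dotProduct_sq_le (x y : ι → ℝ) : (x ⬝ᵥ y) ^ 2 ≤ (x ⬝ᵥ x) * (y ⬝ᵥ y) := by
  have h := Finset.sum_mul_sq_le_sq_mul_sq Finset.univ x y
  simpa [dotProduct, pow_two] using h

variable [DecidableEq ι]

theorem mulVec_dotProduct_self_le (A : Matrix ι ι ℝ) (x : ι → ℝ) :
    (A *ᵥ x) ⬝ᵥ (A *ᵥ x) ≤ ‖A‖ ^ 2 * (x ⬝ᵥ x) := by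
  rw [← norm_toLp_sq, ← norm_toLp_sq, ← mul_pow]
  exact pow_le_pow_left₀ (norm_nonneg _) (Matrix.l2_opNorm_mulVec A (WithLp.toLp 2 x)) 2

theorem l2_opNorm_le_of_forall {A : Matrix ι ι ℝ} {C : ℝ} (hC : 0 ≤ C)
    (h : ∀ x : ι → ℝ, (A *ᵥ x) ⬝ᵥ (A *ᵥ x) ≤ C ^ 2 * (x ⬝ᵥ x)) : ‖A‖ ≤ C := by
  rw [← Matrix.l2_opNorm_toEuclideanCLM]
  refine ContinuousLinearMap.opNorm_le_bound _ hC fun x => ?_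
  refine abs_le_of_sq_le_sq' ?_ (by positivity) |>.2
  have h1 := h x.ofLp
  rw [← norm_toLp_sq, ← norm_toLp_sq, ← mul_pow] at h1
  exact h1

theorem abs_dotProduct_mulVec_le (A : Matrix ι ι ℝ) (x : ι → ℝ) :
    |x ⬝ᵥ A *ᵥ x| ≤ ‖A‖ * (x ⬝ᵥ x) := by
  have hx := dotProduct_self_nonneg_real x
  refine abs_le_of_sq_le_sq ?_ (by positivity)
  calc _ ≤ (x ⬝ᵥ x) * ((A *ᵥ x) ⬝ᵥ (A *ᵥ x)) := dotProduct_sq_le _ _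
    _ ≤ (x ⬝ᵥ x) * (‖A‖ ^ 2 * (x ⬝ᵥ x)) :=
        mul_le_mul_of_nonneg_left (mulVec_dotProduct_self_le A x) hx
    _ = _ := by ring

open scoped MatrixOrder in
theorem exists_eq_transpose_mul_self {A : Matrix ι ι ℝ} (hA : A.PosDef) :
    ∃ B : Matrix ι ι ℝ, A = Bᵀ * B :=
  CStarAlgebra.nonneg_iff_eq_star_mul_self.mp hA.posSemidef.nonneg

theorem exists_pos_forall_le_of_posDef {A : Matrix ι ι ℝ} (hA : A.PosDef) :
    ∃ c : ℝ, 0 < c ∧ ∀ x : ι → ℝ, c * (x ⬝ᵥ x) ≤ x ⬝ᵥ A *ᵥ x := by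
  obtain ⟨B, hB⟩ := exists_eq_transpose_mul_self hA
  -- `B` is bounded below because it has the left inverse `A⁻¹ Bᵀ`.
  set C := A⁻¹ * Bᵀ with hC
  have hCB : C * B = 1 := by
    rw [hC, Matrix.mul_assoc, ← hB, Matrix.nonsing_inv_mul _ ((Matrix.isUnit_iff_isUnit_det _).1
      hA.isUnit)]
  refine ⟨(‖C‖ ^ 2 + 1)⁻¹, by positivity, fun x => ?_⟩
  rw [inv_mul_le_iff₀ (by positivity)]
  have h1 : x ⬝ᵥ A *ᵥ x = (B *ᵥ x) ⬝ᵥ (B *ᵥ x) := by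
    rw [hB, ← Matrix.mulVec_mulVec, Matrix.dotProduct_mulVec, Matrix.vecMul_transpose]
  have h2 := mulVec_dotProduct_self_le C (B *ᵥ x)
  rw [Matrix.mulVec_mulVec, hCB, Matrix.one_mulVec] at h2
  rw [h1]
  nlinarith [dotProduct_self_nonneg_real (B *ᵥ x)]

/-- If a symmetric matrix lies between `a` and `b` (as a form, resp. in norm), its inverse is
positive definite with norm at most `1 / a` and lies above `a / b²`. -/
theorem inv_bounds {J : Matrix ι ι ℝ} (hJ : J.IsHermitian) {a b : ℝ} (ha : 0 < a) (hb : 0 < b)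
    (hlow : ∀ x : ι → ℝ, a * (x ⬝ᵥ x) ≤ x ⬝ᵥ J *ᵥ x) (hup : ‖J‖ ≤ b) :
    J.PosDef ∧ ‖J⁻¹‖ ≤ 1 / a ∧ ∀ x : ι → ℝ, a / b ^ 2 * (x ⬝ᵥ x) ≤ x ⬝ᵥ J⁻¹ *ᵥ x := by
  have hpd : J.PosDef := by
    refine Matrix.PosDef.of_dotProduct_mulVec_pos hJ fun x hx => ?_
    rw [star_trivial]
    refine lt_of_lt_of_le (mul_pos ha ?_) (hlow x)
    exact lt_of_le_of_ne (dotProduct_self_nonneg_real x) fun h => hx (dotProduct_self_eq_zero.1 h.symm)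
  have hdet := (Matrix.isUnit_iff_isUnit_det _).1 hpd.isUnit
  have hinv : ∀ x : ι → ℝ, J *ᵥ (J⁻¹ *ᵥ x) = x := fun x => by
    rw [Matrix.mulVec_mulVec, Matrix.mul_nonsing_inv _ hdet, Matrix.one_mulVec]
  have hq : ∀ x : ι → ℝ, a * ((J⁻¹ *ᵥ x) ⬝ᵥ (J⁻¹ *ᵥ x)) ≤ x ⬝ᵥ J⁻¹ *ᵥ x := fun x => by
    have h := hlow (J⁻¹ *ᵥ x)
    rwa [hinv, dotProduct_comm _ x] at h
  refine ⟨hpd, l2_opNorm_le_of_forall (by positivity) fun x => ?_, fun x => ?_⟩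
  · set y := J⁻¹ *ᵥ x
    have h1 := hq x
    have h2 := dotProduct_sq_le x y
    have hy := dotProduct_self_nonneg_real y
    have hx := dotProduct_self_nonneg_real x
    have h3 : a ^ 2 * (y ⬝ᵥ y) ≤ x ⬝ᵥ x := by
      rcases hy.eq_or_lt with h0 | h0
      · rw [← h0]; simpa using hx
      · have h4 : (a * (y ⬝ᵥ y)) ^ 2 ≤ (x ⬝ᵥ x) * (y ⬝ᵥ y) :=
          (pow_le_pow_left₀ (by positivity) h1 2).trans h2
        refine le_of_mul_le_mul_right ?_ h0
        linarith
    rw [div_pow, one_pow, one_div, ← div_eq_inv_mul, le_div_iff₀ (by positivity)]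
    linarith
  · refine le_trans ?_ (hq x)
    have h := mulVec_dotProduct_self_le J (J⁻¹ *ᵥ x)
    rw [hinv] at h
    have hy := dotProduct_self_nonneg_real (J⁻¹ *ᵥ x)
    have h2 : x ⬝ᵥ x ≤ b ^ 2 * ((J⁻¹ *ᵥ x) ⬝ᵥ (J⁻¹ *ᵥ x)) :=
      h.trans (mul_le_mul_of_nonneg_right (pow_le_pow_left₀ (norm_nonneg _) hup 2) hy)
    rw [div_mul_eq_mul_div, div_le_iff₀ (by positivity)]
    nlinarith

/-- The inverse of the flat information matrix is of exact order `1 / N`. -/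
theorem exists_flatFim_inv_bounds {L : ℕ} {σ : ℝ} {τ : Fin L → ℝ} {β : Fin L → ℂ} (hσ : 0 < σ)
    (hτ : Function.Injective τ) (hβ : ∀ l, β l ≠ 0) :
    ∃ c C : ℝ, 0 < c ∧ 0 < C ∧ ∀ᶠ N : ℕ in atTop, 0 < N ∧ (flatFim σ τ β N).PosDef ∧
      ‖(flatFim σ τ β N)⁻¹‖ ≤ C / N ∧
      ∀ x, c / N * (x ⬝ᵥ x) ≤ x ⬝ᵥ (flatFim σ τ β N)⁻¹ *ᵥ x := by
  obtain ⟨a, ha, hlow⟩ := exists_pos_forall_le_of_posDef (posDef_limitFim σ τ β hσ hτ hβ)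
  have hlim := tendsto_flatFim σ τ β
  refine ⟨a / 2 / (‖limitFim σ τ β‖ + a) ^ 2, 1 / (a / 2), by positivity, by positivity, ?_⟩
  filter_upwards [Metric.tendsto_nhds.1 hlim (a / 2) (half_pos ha), eventually_gt_atTop 0]
    with N hN hN0
  have hNpos : (0 : ℝ) < N := by exact_mod_cast hN0
  set J := flatFim σ τ β N
  have hJ : J = (N : ℝ) • ((N : ℝ)⁻¹ • J) := by
    rw [smul_smul, mul_inv_cancel₀ hNpos.ne', one_smul]
  rw [dist_eq_norm] at hN
  have hsymm : J.IsHermitian := by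
    ext k l
    simp only [J, Matrix.conjTranspose_apply, flatFim, Matrix.sum_apply, star_trivial]
    exact Finset.sum_congr rfl fun n _ => infoDensity_comm σ τ β _ l k
  have h := inv_bounds hsymm (a := N * (a / 2)) (b := N * (‖limitFim σ τ β‖ + a))
    (by positivity) (by positivity) ?_ ?_
  · refine ⟨hN0, h.1, h.2.1.trans_eq ?_, fun x => le_of_eq_of_le ?_ (h.2.2 x)⟩
    · field_simp
    · field_simp
  · intro x
    have h1 := (abs_le.1 (abs_dotProduct_mulVec_le ((N : ℝ)⁻¹ • J - limitFim σ τ β) x)).1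
    have h2 := hlow x
    have hx := dotProduct_self_nonneg_real x
    rw [Matrix.sub_mulVec, dotProduct_sub] at h1
    rw [hJ, Matrix.smul_mulVec, dotProduct_smul, smul_eq_mul, mul_assoc]
    refine mul_le_mul_of_nonneg_left ?_ hNpos.le
    nlinarith [mul_le_mul_of_nonneg_right hN.le hx]
  · rw [hJ, norm_smul, Real.norm_of_nonneg hNpos.le]
    refine mul_le_mul_of_nonneg_left ?_ hNpos.le
    calc ‖(N : ℝ)⁻¹ • J‖ = ‖limitFim σ τ β + ((N : ℝ)⁻¹ • J - limitFim σ τ β)‖ := by abel_nf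
      _ ≤ _ := (norm_add_le _ _).trans (by linarith)

end Bounds

/-! ### Expansion of the trace of the inverse to second order -/

section Expansion

open scoped Matrix.Norms.L2Operator

variable {ι : Type*} [Fintype ι]

theorem trace_transpose_mul_self (M : Matrix ι ι ℝ) :
    (Mᵀ * M).trace = ∑ a, ∑ b, M a b ^ 2 := by
  rw [Finset.sum_comm, Matrix.trace]
  refine Finset.sum_congr rfl fun b _ => ?_
  rw [Matrix.diag_apply, Matrix.mul_apply]
  exact Finset.sum_congr rfl fun a _ => by rw [Matrix.transpose_apply, pow_two]

variable [DecidableEq ι]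

theorem abs_trace_le (A : Matrix ι ι ℝ) : |A.trace| ≤ Fintype.card ι * ‖A‖ := by
  refine (Finset.abs_sum_le_sum_abs _ _).trans ?_
  refine (Finset.sum_le_card_nsmul _ _ ‖A‖ fun i _ => ?_).trans_eq (by simp)
  have h := abs_dotProduct_mulVec_le A (Pi.single i 1)
  simpa using h

theorem l2_opNorm_one_le : ‖(1 : Matrix ι ι ℝ)‖ ≤ 1 :=
  l2_opNorm_le_of_forall zero_le_one fun x => by simp

theorem l2_opNorm_pow_four_le (A : Matrix ι ι ℝ) :
    ‖A‖ ^ 4 ≤ (Fintype.card ι : ℝ) ^ 2 * ∑ a, ∑ b, A a b ^ 4 := by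
  have h1 : ‖A‖ ^ 2 ≤ ∑ a, ∑ b, A a b ^ 2 := by
    have h0 : 0 ≤ ∑ a, ∑ b, A a b ^ 2 :=
      Finset.sum_nonneg fun _ _ => Finset.sum_nonneg fun _ _ => sq_nonneg _
    rw [← Real.sq_sqrt h0]
    refine pow_le_pow_left₀ (norm_nonneg _) (l2_opNorm_le_of_forall (Real.sqrt_nonneg _)
      fun x => ?_) 2
    rw [Real.sq_sqrt h0, dotProduct, Finset.sum_mul]
    refine Finset.sum_le_sum fun a _ => ?_
    have h := dotProduct_sq_le (A a) x
    rw [← pow_two, Matrix.mulVec]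
    refine h.trans_eq ?_
    simp only [dotProduct, pow_two]
  have h2 : (∑ a, ∑ b, A a b ^ 2) ^ 2 ≤
      (Fintype.card ι : ℝ) ^ 2 * ∑ a, ∑ b, A a b ^ 4 := by
    rw [← Fintype.sum_prod_type', ← Fintype.sum_prod_type']
    refine (sq_sum_le_card_mul_sum_sq).trans_eq ?_
    rw [Finset.card_univ, Fintype.card_prod]
    simp only [← pow_mul]
    push_cast
    ring
  calc ‖A‖ ^ 4 = (‖A‖ ^ 2) ^ 2 := by ring
    _ ≤ _ := (pow_le_pow_left₀ (by positivity) h1 2).trans h2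

/-- The inverse of `J = J₀ (1 + Z)` for small `Z`, with the Neumann series stopped after the
quadratic term. -/
theorem abs_trace_inv_expansion_le {J J₀ Z : Matrix ι ι ℝ} {ρ : ℝ} (hρ1 : ρ < 1)
    (hJ : J = J₀ * (1 + Z)) (hJ₀ : IsUnit J₀) (hZ : ‖Z‖ < ρ) :
    IsUnit J ∧ |(J⁻¹).trace - (J₀⁻¹).trace + (Z * J₀⁻¹).trace - (Z * Z * J₀⁻¹).trace| ≤
      Fintype.card ι * (‖J₀⁻¹‖ * (1 / (1 - ρ) * ‖Z‖ ^ 3)) := by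
  have hu : IsUnit (1 + Z) := by
    have h := isUnit_one_sub_of_norm_lt_one (x := -Z) (by rw [norm_neg]; linarith)
    rwa [sub_neg_eq_add] at h
  have hdet := (Matrix.isUnit_iff_isUnit_det _).1 hu
  refine ⟨hJ ▸ hJ₀.mul hu, ?_⟩
  set R := (1 + Z)⁻¹ with hR
  have hR1 : R = 1 - Z * R := by
    have h : (1 + Z) * R = 1 := Matrix.mul_nonsing_inv _ hdet
    rw [add_mul, one_mul] at h
    exact eq_sub_of_add_eq h
  have hRn : ‖R‖ ≤ 1 / (1 - ρ) := by
    have h1 : ‖R‖ ≤ 1 + ‖Z‖ * ‖R‖ := by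
      calc ‖R‖ = ‖1 - Z * R‖ := by rw [← hR1]
        _ ≤ ‖(1 : Matrix ι ι ℝ)‖ + ‖Z * R‖ := norm_sub_le _ _
        _ ≤ _ := add_le_add l2_opNorm_one_le (norm_mul_le _ _)
    rw [le_div_iff₀ (by linarith)]
    nlinarith [norm_nonneg R]
  have hR3 : R = 1 - Z + Z * Z - Z * Z * Z * R := by
    have h2 : Z * R = Z - Z * Z * R := by
      nth_rw 1 [hR1]; rw [mul_sub, mul_one, mul_assoc]
    have h3 : Z * Z * R = Z * Z - Z * Z * Z * R := by
      nth_rw 1 [hR1]; rw [mul_sub, mul_one, mul_assoc (Z * Z)]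
    nth_rw 1 [hR1]
    rw [h2, h3]
    abel
  have hJi : J⁻¹ = R * J₀⁻¹ := by rw [hJ, Matrix.mul_inv_rev]
  have hkey : (J⁻¹).trace - (J₀⁻¹).trace + (Z * J₀⁻¹).trace - (Z * Z * J₀⁻¹).trace =
      -(Z * Z * Z * R * J₀⁻¹).trace := by
    rw [hJi]
    nth_rw 1 [hR3]
    simp only [add_mul, sub_mul, one_mul, Matrix.trace_add, Matrix.trace_sub]
    ring
  rw [hkey, abs_neg]
  refine (abs_trace_le _).trans (mul_le_mul_of_nonneg_left ?_ (Nat.cast_nonneg _))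
  calc ‖Z * Z * Z * R * J₀⁻¹‖ ≤ ‖Z * Z * Z * R‖ * ‖J₀⁻¹‖ := norm_mul_le _ _
    _ ≤ (‖Z * Z * Z‖ * ‖R‖) * ‖J₀⁻¹‖ := by gcongr; exact norm_mul_le _ _
    _ ≤ (‖Z‖ ^ 3 * (1 / (1 - ρ))) * ‖J₀⁻¹‖ := by
        gcongr
        calc ‖Z * Z * Z‖ ≤ ‖Z * Z‖ * ‖Z‖ := norm_mul_le _ _
          _ ≤ ‖Z‖ * ‖Z‖ * ‖Z‖ := by gcongr; exact norm_mul_le _ _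
          _ = ‖Z‖ ^ 3 := by ring
    _ = _ := by ring

/-- The constant in front of the cubic remainder. -/
def remainderConst (ρ : ℝ) : ℝ := 1 / (1 - ρ) + 1 / ρ ^ 2 + 1 / ρ

theorem remainderConst_pos {ρ : ℝ} (hρ0 : 0 < ρ) (hρ1 : ρ < 1) : 0 < remainderConst ρ := by
  have : 0 < 1 - ρ := by linarith
  unfold remainderConst
  positivity

/-- Off the event `‖Z‖ < ρ` the linear and quadratic terms are themselves of cubic order, so that
the truncated expansion has a cubic remainder everywhere. -/
theorem abs_truncated_expansion_le {J J₀ Z : Matrix ι ι ℝ} {ρ : ℝ} (hρ0 : 0 < ρ) (hρ1 : ρ < 1)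
    (hJ : J = J₀ * (1 + Z)) (hJ₀ : IsUnit J₀) :
    |(if ‖Z‖ < ρ then (J⁻¹).trace - (J₀⁻¹).trace else 0) + (Z * J₀⁻¹).trace -
      (Z * Z * J₀⁻¹).trace| ≤
      Fintype.card ι * (‖J₀⁻¹‖ * (remainderConst ρ * ‖Z‖ ^ 3)) := by
  have hρ2 : 0 < 1 - ρ := by linarith
  split_ifs with h
  · refine ((abs_trace_inv_expansion_le hρ1 hJ hJ₀ h).2).trans ?_
    gcongr
    rw [remainderConst, add_assoc]
    exact le_add_of_nonneg_right (by positivity)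
  · rw [not_lt] at h
    rw [zero_add, ← Matrix.trace_sub]
    refine (abs_trace_le _).trans (mul_le_mul_of_nonneg_left ?_ (Nat.cast_nonneg _))
    set t := ‖Z‖
    have h1 : t ≤ 1 / ρ ^ 2 * t ^ 3 := by
      rw [one_div, ← div_eq_inv_mul, le_div_iff₀ (by positivity)]
      nlinarith [norm_nonneg Z, mul_le_mul h h hρ0.le (hρ0.le.trans h)]
    have h2 : t * t ≤ 1 / ρ * t ^ 3 := by
      rw [one_div, ← div_eq_inv_mul, le_div_iff₀ hρ0]
      nlinarith [mul_le_mul_of_nonneg_left h (mul_self_nonneg t)]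
    calc ‖Z * J₀⁻¹ - Z * Z * J₀⁻¹‖ ≤ ‖Z * J₀⁻¹‖ + ‖Z * Z * J₀⁻¹‖ := norm_sub_le _ _
      _ ≤ t * ‖J₀⁻¹‖ + t * t * ‖J₀⁻¹‖ := by
          refine add_le_add (norm_mul_le _ _) ((norm_mul_le _ _).trans ?_)
          gcongr
          exact norm_mul_le _ _
      _ = ‖J₀⁻¹‖ * (t + t * t) := by ring
      _ ≤ _ := by
          refine mul_le_mul_of_nonneg_left ?_ (norm_nonneg _)
          have h3 : 0 ≤ 1 / (1 - ρ) * t ^ 3 := by positivity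
          rw [remainderConst, add_mul, add_mul]
          linarith

/-- The conditional mean of the trace of the inverse, given `‖Z‖ < ρ`, agrees with its second
order expansion up to a cubic error. -/
theorem abs_cond_expect_trace_inv_sub_le {Ω : Type*} [Fintype Ω] [Nonempty Ω]
    {J₀ : Matrix ι ι ℝ} {J Z : Ω → Matrix ι ι ℝ} {ρ ε : ℝ} (hρ0 : 0 < ρ) (hρ1 : ρ < 1)
    (hε0 : 0 < ε) (hε1 : ε ≤ 1) (hερ : ε ^ 4 ≤ ρ ^ 4 / 2)
    (hJ : ∀ ω, J ω = J₀ * (1 + Z ω)) (hJ₀ : IsUnit J₀)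
    (hmean : 𝔼 ω, (Z ω * J₀⁻¹).trace = 0) (hfour : 𝔼 ω, ‖Z ω‖ ^ 4 ≤ ε ^ 4) :
    1 / 2 ≤ 𝔼 ω, (if ‖Z ω‖ < ρ then (1 : ℝ) else 0) ∧
    |(𝔼 ω, (if ‖Z ω‖ < ρ then (1 : ℝ) else 0))⁻¹ *
        (𝔼 ω, if ‖Z ω‖ < ρ then ((J ω)⁻¹).trace else 0) - (J₀⁻¹).trace -
        𝔼 ω, (Z ω * Z ω * J₀⁻¹).trace| ≤
      2 * (Fintype.card ι * (‖J₀⁻¹‖ * ((remainderConst ρ + 1 / ρ ^ 4) * ε ^ 3))) := by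
  set d := (Fintype.card ι : ℝ)
  have hd : 0 ≤ d := Nat.cast_nonneg _
  set k := ‖J₀⁻¹‖
  have hk : 0 ≤ k := norm_nonneg _
  set P := 𝔼 ω, (if ‖Z ω‖ < ρ then (1 : ℝ) else 0) with hP
  set T := 𝔼 ω, (Z ω * Z ω * J₀⁻¹).trace with hT
  -- The lower moments follow from the fourth by weighted arithmetic-geometric inequalities.
  have hm2 : 𝔼 ω, ‖Z ω‖ ^ 2 ≤ ε ^ 2 := by
    have h : ∀ ω ∈ Finset.univ, ‖Z ω‖ ^ 2 ≤ 1 / 2 * ε ^ 2 + 1 / (2 * ε ^ 2) * ‖Z ω‖ ^ 4 := by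
      intro ω _
      have h1 : 1 / 2 * ε ^ 2 + 1 / (2 * ε ^ 2) * ‖Z ω‖ ^ 4 - ‖Z ω‖ ^ 2 =
          (‖Z ω‖ ^ 2 - ε ^ 2) ^ 2 / (2 * ε ^ 2) := by field_simp; ring
      have : 0 ≤ (‖Z ω‖ ^ 2 - ε ^ 2) ^ 2 / (2 * ε ^ 2) := by positivity
      linarith
    refine (Finset.expect_le_expect h).trans ?_
    rw [Finset.expect_add_distrib, Fintype.expect_const, ← Finset.mul_expect]
    have h2 : 1 / (2 * ε ^ 2) * 𝔼 ω, ‖Z ω‖ ^ 4 ≤ 1 / (2 * ε ^ 2) * ε ^ 4 := by gcongr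
    refine (add_le_add_right h2 _).trans_eq ?_
    field_simp
    ring
  have hm3 : 𝔼 ω, ‖Z ω‖ ^ 3 ≤ ε ^ 3 := by
    have h : ∀ ω ∈ Finset.univ, ‖Z ω‖ ^ 3 ≤ ε / 2 * ‖Z ω‖ ^ 2 + 1 / (2 * ε) * ‖Z ω‖ ^ 4 := by
      intro ω _
      have h1 : ε / 2 * ‖Z ω‖ ^ 2 + 1 / (2 * ε) * ‖Z ω‖ ^ 4 - ‖Z ω‖ ^ 3 =
          ‖Z ω‖ ^ 2 * (‖Z ω‖ - ε) ^ 2 / (2 * ε) := by field_simp; ring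
      have : 0 ≤ ‖Z ω‖ ^ 2 * (‖Z ω‖ - ε) ^ 2 / (2 * ε) := by positivity
      linarith
    refine (Finset.expect_le_expect h).trans ?_
    rw [Finset.expect_add_distrib, ← Finset.mul_expect, ← Finset.mul_expect]
    have h2 : 1 / (2 * ε) * 𝔼 ω, ‖Z ω‖ ^ 4 ≤ 1 / (2 * ε) * ε ^ 4 := by gcongr
    have h3 : ε / 2 * 𝔼 ω, ‖Z ω‖ ^ 2 ≤ ε / 2 * ε ^ 2 := by gcongr
    refine (add_le_add h3 h2).trans_eq ?_
    field_simp
    ring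
  -- Markov's inequality for the fourth power.
  have hq : 1 - P ≤ ε ^ 4 / ρ ^ 4 := by
    have h : ∀ ω ∈ Finset.univ, 1 - (if ‖Z ω‖ < ρ then (1 : ℝ) else 0) ≤
        1 / ρ ^ 4 * ‖Z ω‖ ^ 4 := by
      intro ω _
      split_ifs with h
      · rw [sub_self]; positivity
      · rw [sub_zero, one_div, ← div_eq_inv_mul, one_le_div (by positivity)]
        exact pow_le_pow_left₀ hρ0.le (not_lt.1 h) 4
    have h1 := Finset.expect_le_expect h
    rw [Finset.expect_sub_distrib, Fintype.expect_const, ← Finset.mul_expect] at h1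
    refine h1.trans ?_
    rw [one_div, ← div_eq_inv_mul]
    gcongr
  have hP2 : 1 / 2 ≤ P := by
    have : ε ^ 4 / ρ ^ 4 ≤ 1 / 2 := by
      rw [div_le_iff₀ (by positivity)]; linarith
    linarith
  have hP1 : P ≤ 1 := by
    refine Finset.expect_le Finset.univ_nonempty fun ω _ => ?_
    split_ifs <;> norm_num
  have hTb : |T| ≤ d * (k * ε ^ 2) := by
    refine (Finset.abs_expect_le _ _).trans ?_
    have h : ∀ ω ∈ Finset.univ, |(Z ω * Z ω * J₀⁻¹).trace| ≤ d * k * ‖Z ω‖ ^ 2 := by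
      intro ω _
      refine (abs_trace_le _).trans ?_
      rw [mul_assoc d]
      refine mul_le_mul_of_nonneg_left ?_ hd
      refine (norm_mul_le _ _).trans ?_
      rw [mul_comm, pow_two]
      exact mul_le_mul_of_nonneg_left (norm_mul_le _ _) hk
    refine (Finset.expect_le_expect h).trans ?_
    rw [← Finset.mul_expect, ← mul_assoc]
    gcongr
  have hmain : |P * ((P)⁻¹ * (𝔼 ω, if ‖Z ω‖ < ρ then ((J ω)⁻¹).trace else 0) -
      (J₀⁻¹).trace) - T| ≤ d * (k * (remainderConst ρ * ε ^ 3)) := by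
    have h1 : P * ((P)⁻¹ * (𝔼 ω, if ‖Z ω‖ < ρ then ((J ω)⁻¹).trace else 0) -
        (J₀⁻¹).trace) - T = 𝔼 ω, ((if ‖Z ω‖ < ρ then ((J ω)⁻¹).trace - (J₀⁻¹).trace else 0) +
          (Z ω * J₀⁻¹).trace - (Z ω * Z ω * J₀⁻¹).trace) := by
      rw [Finset.expect_sub_distrib, Finset.expect_add_distrib, hmean, mul_sub, ← mul_assoc,
        mul_inv_cancel₀ (by linarith), one_mul, hP, Finset.expect_mul, ← Finset.expect_sub_distrib,
        add_zero]
      congr 1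
      refine Finset.expect_congr rfl fun ω _ => ?_
      split_ifs <;> simp
    rw [h1]
    refine (Finset.abs_expect_le _ _).trans ?_
    refine (Finset.expect_le_expect fun ω _ =>
      abs_truncated_expansion_le hρ0 hρ1 (hJ ω) hJ₀).trans ?_
    rw [← Finset.mul_expect, ← Finset.mul_expect, ← Finset.mul_expect]
    have := remainderConst_pos hρ0 hρ1
    gcongr
  refine ⟨hP2, ?_⟩
  set X := (P)⁻¹ * (𝔼 ω, if ‖Z ω‖ < ρ then ((J ω)⁻¹).trace else 0) - (J₀⁻¹).trace
  have h1 : |P * (X - T)| ≤ d * (k * (remainderConst ρ * ε ^ 3)) +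
      d * (k * (1 / ρ ^ 4 * ε ^ 3)) := by
    have h2 : P * (X - T) = (P * X - T) + (1 - P) * T := by ring
    rw [h2]
    refine (abs_add_le _ _).trans (add_le_add hmain ?_)
    rw [abs_mul, abs_of_nonneg (by linarith)]
    calc (1 - P) * |T| ≤ ε ^ 4 / ρ ^ 4 * (d * (k * ε ^ 2)) := by gcongr
      _ = d * (k * (1 / ρ ^ 4 * (ε ^ 3 * ε ^ 3))) := by ring
      _ ≤ d * (k * (1 / ρ ^ 4 * (ε ^ 3 * 1))) := by
          gcongr
          exact pow_le_one₀ hε0.le hε1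
      _ = _ := by rw [mul_one]
  rw [abs_mul, abs_of_pos (by linarith)] at h1
  have h3 : 1 / 2 * |X - T| ≤ P * |X - T| := by gcongr
  calc |X - T| ≤ 2 * (d * (k * (remainderConst ρ * ε ^ 3)) + d * (k * (1 / ρ ^ 4 * ε ^ 3))) := by
        linarith
    _ = _ := by ring

/-- Cubic lower bound for the quadratic term of the expansion: if `K = Bᵀ B` dominates `k`, then
`∑ (B D K)² = tr (K D K D K)` dominates `k³ ∑ D²`. -/
theorem pow_three_mul_sum_sq_le {K B D : Matrix ι ι ℝ} {k : ℝ} (hk : 0 ≤ k) (hKB : K = Bᵀ * B)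
    (hD : Dᵀ = D) (hlow : ∀ x : ι → ℝ, k * (x ⬝ᵥ x) ≤ x ⬝ᵥ K *ᵥ x) :
    k ^ 3 * ∑ a, ∑ b, D a b ^ 2 ≤ ∑ a, ∑ b, (B * D * K) a b ^ 2 := by
  have hK : Kᵀ = K := by rw [hKB, Matrix.transpose_mul, Matrix.transpose_transpose]
  have hcol : ∀ M : Matrix ι ι ℝ, ∑ a, ∑ b, M a b ^ 2 =
      ∑ b, (M *ᵥ Pi.single b 1) ⬝ᵥ (M *ᵥ Pi.single b 1) := by
    intro M
    rw [Finset.sum_comm]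
    refine Finset.sum_congr rfl fun b _ => ?_
    simp only [dotProduct, Matrix.mulVec_single_one, Matrix.col_apply, pow_two]
  have hsq : ∀ x : ι → ℝ, k ^ 2 * (x ⬝ᵥ x) ≤ (K *ᵥ x) ⬝ᵥ (K *ᵥ x) := by
    intro x
    have h1 := hlow x
    have h2 := dotProduct_sq_le x (K *ᵥ x)
    have hx := dotProduct_self_nonneg_real x
    rcases hx.eq_or_lt with h0 | h0
    · rw [← h0, mul_zero]; exact dotProduct_self_nonneg_real _
    · have h4 := (pow_le_pow_left₀ (by positivity) h1 2).trans h2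
      refine le_of_mul_le_mul_left ?_ h0
      linarith
  have hB : ∀ x : ι → ℝ, k * (x ⬝ᵥ x) ≤ (B *ᵥ x) ⬝ᵥ (B *ᵥ x) := by
    intro x
    refine (hlow x).trans_eq ?_
    rw [hKB, ← Matrix.mulVec_mulVec, Matrix.dotProduct_mulVec, Matrix.vecMul_transpose]
  have h1 : k * ∑ a, ∑ b, (D * K) a b ^ 2 ≤ ∑ a, ∑ b, (B * D * K) a b ^ 2 := by
    rw [hcol, hcol, Finset.mul_sum]
    refine Finset.sum_le_sum fun b _ => ?_
    rw [Matrix.mul_assoc, ← Matrix.mulVec_mulVec _ B]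
    exact hB _
  have h2 : ∑ a, ∑ b, (D * K) a b ^ 2 = ∑ a, ∑ b, (K * D) a b ^ 2 := by
    rw [Finset.sum_comm]
    refine Finset.sum_congr rfl fun b _ => Finset.sum_congr rfl fun a _ => ?_
    rw [← Matrix.transpose_apply (D * K), Matrix.transpose_mul, hK, hD]
  have h3 : k ^ 2 * ∑ a, ∑ b, D a b ^ 2 ≤ ∑ a, ∑ b, (K * D) a b ^ 2 := by
    rw [hcol, hcol, Finset.mul_sum]
    refine Finset.sum_le_sum fun b _ => ?_
    rw [← Matrix.mulVec_mulVec _ K]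
    exact hsq _
  calc _ = k * (k ^ 2 * ∑ a, ∑ b, D a b ^ 2) := by ring
    _ ≤ k * ∑ a, ∑ b, (D * K) a b ^ 2 := by rw [h2]; gcongr
    _ ≤ _ := h1

end Expansion

/-! ### Second-order expansion of the conditional Cramér–Rao bound -/

section Asymptotics

open scoped Matrix.Norms.L2Operator

variable {S : Finset ℂ} {L N : ℕ} {σ : ℝ} {τ : Fin L → ℝ} {β : Fin L → ℂ}

theorem fim_sub_flatFim (U : Matrix (Fin N) (Fin N) ℂ) (s : Fin N → ℂ) :
    fim σ τ β U s - flatFim σ τ β N =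
      ∑ n, (‖((dft N * U) *ᵥ s) n‖ ^ 2 - 1) • infoDensity σ τ β (freq n) := by
  ext k l
  rw [fim_sub_flatFim_apply, powerFluct, Matrix.sum_apply]
  exact Finset.sum_congr rfl fun n _ => by rw [Matrix.smul_apply, smul_eq_mul, mul_comm]

/-- Every entry of a two-sided product with the fluctuation of the information matrix is a
fluctuation of a weighted power spectrum. -/
theorem mul_fim_sub_mul_apply (U : Matrix (Fin N) (Fin N) ℂ) (s : Fin N → ℂ)
    (A B : Matrix (ParamIdx L) (ParamIdx L) ℝ) (a b : ParamIdx L) :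
    (A * (fim σ τ β U s - flatFim σ τ β N) * B) a b =
      powerFluct (dft N * U) (fun n => (A * infoDensity σ τ β (freq n) * B) a b) s := by
  rw [fim_sub_flatFim, Matrix.mul_sum, Matrix.sum_mul, Matrix.sum_apply, powerFluct]
  refine Finset.sum_congr rfl fun n _ => ?_
  rw [Matrix.mul_smul, Matrix.smul_mul, Matrix.smul_apply, smul_eq_mul, mul_comm]

theorem transpose_infoDensity (f : ℝ) : (infoDensity σ τ β f)ᵀ = infoDensity σ τ β f := by
  ext k l
  exact infoDensity_comm σ τ β f l k

theorem transpose_fim_sub_flatFim (U : Matrix (Fin N) (Fin N) ℂ) (s : Fin N → ℂ) :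
    (fim σ τ β U s - flatFim σ τ β N)ᵀ = fim σ τ β U s - flatFim σ τ β N := by
  rw [fim_sub_flatFim, Matrix.transpose_sum]
  exact Finset.sum_congr rfl fun n _ => by rw [Matrix.transpose_smul, transpose_infoDensity]

theorem fluct_eq (hS : IsSubGaussianConstellation S) {U : Matrix (Fin N) (Fin N) ℂ}
    (hU : U ∈ Matrix.unitaryGroup (Fin N) ℂ) (s : Fin N → ℂ) :
    fluct S σ τ β U s =
      (flatFim σ τ β N)⁻¹ * (fim σ τ β U s - flatFim σ τ β N) := by
  rw [fluct, meanFim_eq_flatFim σ τ β hS hU]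

theorem mem_goodEvent_iff {ρ : ℝ} {U : Matrix (Fin N) (Fin N) ℂ} {s : Fin N → ℂ} :
    s ∈ goodEvent S σ ρ τ β U ↔ ‖fluct S σ τ β U s‖ < ρ := by
  rw [goodEvent, Set.mem_ofPred_eq, Matrix.l2_opNorm_toEuclideanCLM]

theorem measurableSet_goodEvent (ρ : ℝ) (U : Matrix (Fin N) (Fin N) ℂ) :
    MeasurableSet (goodEvent S σ ρ τ β U) := by
  have hfim : Continuous fun s => fim σ τ β U s := by
    refine continuous_matrix fun k l => ?_
    simp only [fim_apply]
    refine continuous_finsetSum _ fun n _ => Continuous.mul (Continuous.pow (Continuous.norm ?_) 2)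
      continuous_const
    exact (continuous_apply n).comp (Continuous.matrix_mulVec continuous_const continuous_id)
  have hfl : Continuous fun s => fluct S σ τ β U s :=
    continuous_const.matrix_mul (hfim.sub continuous_const)
  have h : goodEvent S σ ρ τ β U = {s | ‖fluct S σ τ β U s‖ < ρ} :=
    Set.ext fun s => mem_goodEvent_iff
  rw [h]
  exact (isOpen_lt hfl.norm continuous_const).measurableSet

/-- The mean of the quadratic term `tr (Z² J₀⁻¹)` in the expansion of `tr J⁻¹` around the mean
information matrix `J₀`. -/
def quadTerm (S : Finset ℂ) (σ : ℝ) (τ : Fin L → ℝ) (β : Fin L → ℂ)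
    (U : Matrix (Fin N) (Fin N) ℂ) : ℝ :=
  𝔼 s : Fin N → S, (fluct S σ τ β U (fun i => s i) * fluct S σ τ β U (fun i => s i) *
    (flatFim σ τ β N)⁻¹).trace

theorem exists_abs_infoDensity_le (σ : ℝ) (τ : Fin L → ℝ) (β : Fin L → ℂ) :
    ∃ G : ℝ, 0 ≤ G ∧ ∀ (N : ℕ) (n : Fin N) (k l : ParamIdx L),
      |infoDensity σ τ β (freq n) k l| ≤ G := by
  have h : ∀ k l : ParamIdx L, ∃ G : ℝ, ∀ f ∈ Set.Icc (0 : ℝ) 1, ‖infoDensity σ τ β f k l‖ ≤ G :=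
    fun k l => isCompact_Icc.exists_bound_of_continuousOn
      (continuous_infoDensity σ τ β k l).continuousOn
  choose G hG using h
  refine ⟨∑ k, ∑ l, |G k l|, Finset.sum_nonneg fun _ _ => Finset.sum_nonneg fun _ _ =>
    abs_nonneg _, fun N n k l => ?_⟩
  have hf : (freq n : ℝ) ∈ Set.Icc (0 : ℝ) 1 :=
    ⟨by unfold freq; positivity, div_le_one_of_le₀ (by exact_mod_cast n.2.le) (Nat.cast_nonneg N)⟩
  calc |infoDensity σ τ β (freq n) k l| ≤ |G k l| := (hG k l _ hf).trans (le_abs_self _)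
    _ ≤ ∑ l, |G k l| := Finset.single_le_sum (f := fun l => |G k l|)
        (fun _ _ => abs_nonneg _) (Finset.mem_univ l)
    _ ≤ _ := Finset.single_le_sum (f := fun k => ∑ l, |G k l|)
        (fun _ _ => Finset.sum_nonneg fun _ _ => abs_nonneg _) (Finset.mem_univ k)

/-- The fourth moment of the fluctuation of the information matrix has order `N²`. -/
theorem exists_expect_norm_fim_sub_pow_four_le (hS : IsSubGaussianConstellation S) (σ : ℝ)
    (τ : Fin L → ℝ) (β : Fin L → ℂ) :
    ∃ C : ℝ, 0 ≤ C ∧ ∀ (N : ℕ) (U : Matrix (Fin N) (Fin N) ℂ),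
      U ∈ Matrix.unitaryGroup (Fin N) ℂ →
        𝔼 s : Fin N → S, ‖fim σ τ β U (fun i => s i) - flatFim σ τ β N‖ ^ 4 ≤ C * N ^ 2 := by
  obtain ⟨C, hC, h4⟩ := exists_expect_powerFluct_pow_four_le hS
  obtain ⟨G, hG0, hG⟩ := exists_abs_infoDensity_le σ τ β
  refine ⟨(Fintype.card (ParamIdx L) : ℝ) ^ 2 *
    ∑ _a : ParamIdx L, ∑ _b : ParamIdx L, C * G ^ 4, by positivity, fun N U hU => ?_⟩
  refine (Finset.expect_le_expect fun s _ => l2_opNorm_pow_four_le _).trans ?_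
  rw [← Finset.mul_expect, mul_assoc]
  refine mul_le_mul_of_nonneg_left ?_ (by positivity)
  rw [Finset.expect_sum_comm, Finset.sum_mul]
  refine Finset.sum_le_sum fun a _ => ?_
  rw [Finset.expect_sum_comm, Finset.sum_mul]
  refine Finset.sum_le_sum fun b _ => ?_
  simp only [fim_sub_flatFim_apply]
  refine (h4 N _ (mul_mem (dft_mem_unitaryGroup N) hU) _).trans ?_
  rw [mul_assoc]
  refine mul_le_mul_of_nonneg_left ?_ hC
  have h1 : ∑ n : Fin N, infoDensity σ τ β (freq n) a b ^ 2 ≤ N * G ^ 2 := by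
    refine (Finset.sum_le_card_nsmul _ _ (G ^ 2) fun n _ => ?_).trans_eq (by simp)
    exact sq_le_sq' (abs_le.1 (hG N n a b)).1 (abs_le.1 (hG N n a b)).2
  calc _ ≤ (N * G ^ 2) ^ 2 :=
        pow_le_pow_left₀ (Finset.sum_nonneg fun _ _ => sq_nonneg _) h1 2
    _ = _ := by ring

/-- The linear term of the expansion has mean zero. -/
theorem expect_trace_fluct_mul (hS : IsSubGaussianConstellation S)
    {U : Matrix (Fin N) (Fin N) ℂ} (hU : U ∈ Matrix.unitaryGroup (Fin N) ℂ) :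
    𝔼 s : Fin N → S,
      (fluct S σ τ β U (fun i => s i) * (flatFim σ τ β N)⁻¹).trace = 0 := by
  simp only [fluct_eq hS hU, Matrix.trace, Matrix.diag_apply, mul_fim_sub_mul_apply]
  rw [Finset.expect_sum_comm]
  exact Finset.sum_eq_zero fun a _ => expect_powerFluct hS (mul_mem (dft_mem_unitaryGroup N) hU) _

/-- Uniformly over unitary waveforms, the conditional Cramér–Rao bound is its second-order
expansion up to an error of order `N ^ (-5/2)`. -/
theorem exists_condFullCRB_expansion (hS : IsSubGaussianConstellation S) (hσ : 0 < σ)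
    (hτ : Function.Injective τ) (hβ : ∀ l, β l ≠ 0) {ρ : ℝ} (hρ0 : 0 < ρ) (hρ1 : ρ < 1) :
    ∃ A : ℝ, 0 ≤ A ∧ ∀ᶠ N : ℕ in atTop, ∀ U : Matrix (Fin N) (Fin N) ℂ,
      U ∈ Matrix.unitaryGroup (Fin N) ℂ →
        0 < symbolVecLaw S N (goodEvent S σ ρ τ β U) ∧
        (∀ s ∈ goodEvent S σ ρ τ β U, IsUnit (fim σ τ β U s)) ∧
        |condFullCRB S σ ρ τ β U - ((flatFim σ τ β N)⁻¹).trace - quadTerm S σ τ β U| ≤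
          A / (N ^ 2 * Real.sqrt N) := by
  have := hS.nonempty.to_subtype
  obtain ⟨c, C, -, hC, hK⟩ := exists_flatFim_inv_bounds hσ hτ hβ
  obtain ⟨C₄, hC₄, h4⟩ := exists_expect_norm_fim_sub_pow_four_le hS σ τ β
  -- The fluctuation `Z` has fourth moment at most `ε⁴` with `ε = D / √N`.
  set D : ℝ := max 1 (C ^ 4 * C₄) with hD
  have hD1 : 1 ≤ D := le_max_left _ _
  have hR := remainderConst_pos hρ0 hρ1
  set R : ℝ := remainderConst ρ + 1 / ρ ^ 4 with hRdef
  have hR0 : 0 < R := by positivity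
  refine ⟨2 * (Fintype.card (ParamIdx L) * (C * (R * D ^ 3))), by positivity, ?_⟩
  have hsqrt : Tendsto (fun N : ℕ => Real.sqrt N) atTop atTop :=
    Real.tendsto_sqrt_atTop.comp tendsto_natCast_atTop_atTop
  have hδ : 0 < min 1 (ρ / 2) := lt_min one_pos (by linarith)
  filter_upwards [hK, hsqrt.eventually_ge_atTop (D / min 1 (ρ / 2))] with N hKN hN U hU
  obtain ⟨hN0, hpd, hKC, -⟩ := hKN
  have hNpos : (0 : ℝ) < N := by exact_mod_cast hN0
  have hsN : 0 < Real.sqrt N := Real.sqrt_pos.2 hNpos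
  have hs2 : Real.sqrt N ^ 2 = N := Real.sq_sqrt hNpos.le
  set ε := D / Real.sqrt N with hε
  have hε0 : 0 < ε := by positivity
  have hεmin : ε ≤ min 1 (ρ / 2) := by
    rw [hε, div_le_iff₀ hsN, mul_comm]
    exact (div_le_iff₀ hδ).1 hN
  have hεm1 : ε ≤ 1 := hεmin.trans (min_le_left _ _)
  have hερ : ε ^ 4 ≤ ρ ^ 4 / 2 := by
    have h := pow_le_pow_left₀ hε0.le (hεmin.trans (min_le_right _ _)) 4
    have h2 : (ρ / 2) ^ 4 = ρ ^ 4 / 16 := by ring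
    have h3 : 0 < ρ ^ 4 := by positivity
    linarith
  have hunit := hpd.isUnit
  have hdet := (Matrix.isUnit_iff_isUnit_det _).1 hunit
  have hJ : ∀ s : Fin N → ℂ, fim σ τ β U s =
      flatFim σ τ β N * (1 + fluct S σ τ β U s) := by
    intro s
    rw [fluct_eq hS hU, mul_add, mul_one, ← Matrix.mul_assoc, Matrix.mul_nonsing_inv _ hdet,
      Matrix.one_mul, add_sub_cancel]
  have hfour : 𝔼 s : Fin N → S, ‖fluct S σ τ β U (fun i => s i)‖ ^ 4 ≤ ε ^ 4 := by
    have h : ∀ s ∈ (Finset.univ : Finset (Fin N → S)),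
        ‖fluct S σ τ β U (fun i => s i)‖ ^ 4 ≤
          (C / N) ^ 4 * ‖fim σ τ β U (fun i => s i) - flatFim σ τ β N‖ ^ 4 := by
      intro s _
      rw [fluct_eq hS hU, ← mul_pow]
      refine pow_le_pow_left₀ (norm_nonneg _) ((norm_mul_le _ _).trans ?_) 4
      gcongr
    refine (Finset.expect_le_expect h).trans ?_
    rw [← Finset.mul_expect]
    calc _ ≤ (C / N) ^ 4 * (C₄ * N ^ 2) := by gcongr; exact h4 N U hU
      _ = C ^ 4 * C₄ / N ^ 2 := by field_simp
      _ ≤ D ^ 4 / N ^ 2 := by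
          gcongr
          exact (le_max_right _ _).trans (le_self_pow₀ hD1 (by norm_num))
      _ = ε ^ 4 := by
          rw [hε, div_pow, show Real.sqrt N ^ 4 = (Real.sqrt N ^ 2) ^ 2 by ring, hs2]
  obtain ⟨hP, hE⟩ := abs_cond_expect_trace_inv_sub_le
    (J := fun s : Fin N → S => fim σ τ β U (fun i => s i))
    (Z := fun s : Fin N → S => fluct S σ τ β U (fun i => s i)) hρ0 hρ1 hε0 hεm1 hερ
    (fun s => hJ _) hunit (expect_trace_fluct_mul hS hU) hfour
  have hmeas := measurableSet_goodEvent (S := S) (σ := σ) (τ := τ) (β := β) ρ U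
  have hind : ∀ (f : (Fin N → ℂ) → ℝ) (s : Fin N → S),
      (goodEvent S σ ρ τ β U).indicator f (fun i => s i) =
        if ‖fluct S σ τ β U (fun i => s i)‖ < ρ then f (fun i => s i) else 0 := by
    intro f s
    classical
    rw [Set.indicator_apply]
    exact if_congr mem_goodEvent_iff rfl rfl
  have hprob : (symbolVecLaw S N).real (goodEvent S σ ρ τ β U) =
      𝔼 s : Fin N → S, (if ‖fluct S σ τ β U (fun i => s i)‖ < ρ then (1 : ℝ) else 0) := by
    rw [symbolVecLaw_real_eq hS.nonempty hmeas]
    exact Finset.expect_congr rfl fun s _ => hind 1 s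
  refine ⟨?_, fun s hs => ?_, ?_⟩
  · have h : 0 < (symbolVecLaw S N).real (goodEvent S σ ρ τ β U) := by
      rw [hprob]; linarith
    exact (ENNReal.toReal_pos_iff.1 h).1
  · exact (abs_trace_inv_expansion_le hρ1 (hJ s) hunit (mem_goodEvent_iff.1 hs)).1
  · rw [condFullCRB, integral_cond_symbolVecLaw hS.nonempty hmeas, hprob]
    simp only [hind]
    refine hE.trans ?_
    calc _ ≤ 2 * (Fintype.card (ParamIdx L) * (C / N * (R * ε ^ 3))) := by gcongr
      _ = _ := by
          have h3 : Real.sqrt N ^ 3 = N * Real.sqrt N := by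
            rw [pow_succ, hs2]
          rw [hε, div_pow, h3]
          field_simp

end Asymptotics

/-! ### Comparison of the quadratic terms -/

section Gap

open scoped Matrix.Norms.L2Operator

variable {S : Finset ℂ} {L N : ℕ} {σ : ℝ} {τ : Fin L → ℝ} {β : Fin L → ℂ}

theorem sum_norm_sq_col {V : Matrix (Fin N) (Fin N) ℂ} (hV : V ∈ Matrix.unitaryGroup (Fin N) ℂ)
    (j : Fin N) : ∑ n, ‖V n j‖ ^ 2 = 1 := by
  have h := congrFun (congrFun (Matrix.mem_unitaryGroup_iff'.1 hV) j) j
  rw [Matrix.mul_apply, Matrix.one_apply_eq] at h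
  have h2 := congrArg Complex.re h
  rw [Complex.re_sum, Complex.one_re] at h2
  rw [← h2]
  refine Finset.sum_congr rfl fun n _ => ?_
  rw [Matrix.star_apply, Complex.sq_norm, Complex.normSq_apply]
  simp

theorem sum_norm_sq_row {V : Matrix (Fin N) (Fin N) ℂ} (hV : V ∈ Matrix.unitaryGroup (Fin N) ℂ)
    (n : Fin N) : ∑ j, ‖V n j‖ ^ 2 = 1 := by
  have h := sum_norm_sq_col (Unitary.star_mem hV) n
  simpa [Matrix.star_apply] using h

/-- The sum of squares, less the squared means under the column spectra, is the sum of the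
variances under the column spectra, because the squared moduli of the entries of a unitary matrix
are doubly stochastic. -/
theorem sum_sq_sub_eq_sum_variance {V : Matrix (Fin N) (Fin N) ℂ}
    (hV : V ∈ Matrix.unitaryGroup (Fin N) ℂ) (g : Fin N → ℝ) :
    ∑ n, g n ^ 2 - ∑ j, (∑ n, ‖V n j‖ ^ 2 * g n) ^ 2 =
      ∑ j, ∑ n, ‖V n j‖ ^ 2 * (g n - ∑ m, ‖V m j‖ ^ 2 * g m) ^ 2 := by
  have h1 : ∑ n, g n ^ 2 = ∑ j, ∑ n, ‖V n j‖ ^ 2 * g n ^ 2 := by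
    rw [Finset.sum_comm]
    refine Finset.sum_congr rfl fun n _ => ?_
    rw [← Finset.sum_mul, sum_norm_sq_row hV, one_mul]
  rw [h1, ← Finset.sum_sub_distrib]
  refine Finset.sum_congr rfl fun j _ => ?_
  set m := ∑ n, ‖V n j‖ ^ 2 * g n with hm
  have h2 : ∀ n, ‖V n j‖ ^ 2 * (g n - m) ^ 2 =
      ‖V n j‖ ^ 2 * g n ^ 2 - 2 * m * (‖V n j‖ ^ 2 * g n) + m ^ 2 * ‖V n j‖ ^ 2 :=
    fun n => by ring
  simp only [h2, Finset.sum_add_distrib, Finset.sum_sub_distrib, ← Finset.mul_sum, ← hm,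
    sum_norm_sq_col hV]
  ring

/-- The quadratic term as a sum of variances of weighted power spectra, for any factorization
`Bᵀ B` of the inverse of the mean information matrix. -/
theorem quadTerm_eq (hS : IsSubGaussianConstellation S) {U : Matrix (Fin N) (Fin N) ℂ}
    (hU : U ∈ Matrix.unitaryGroup (Fin N) ℂ) {B : Matrix (ParamIdx L) (ParamIdx L) ℝ}
    (hB : (flatFim σ τ β N)⁻¹ = Bᵀ * B) :
    quadTerm S σ τ β U = ∑ a, ∑ b,
      (∑ n : Fin N, (B * infoDensity σ τ β (freq n) * (flatFim σ τ β N)⁻¹) a b ^ 2 -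
        (2 - kurtosis S) * ∑ j, (∑ n : Fin N, ‖(dft N * U) n j‖ ^ 2 *
          (B * infoDensity σ τ β (freq n) * (flatFim σ τ β N)⁻¹) a b) ^ 2) := by
  set K := (flatFim σ τ β N)⁻¹ with hK
  have hKt : Kᵀ = K := by rw [hB, Matrix.transpose_mul, Matrix.transpose_transpose]
  have h : ∀ s : Fin N → ℂ, (fluct S σ τ β U s * fluct S σ τ β U s * K).trace =
      ∑ a, ∑ b, powerFluct (dft N * U)
        (fun n => (B * infoDensity σ τ β (freq n) * K) a b) s ^ 2 := by
    intro s
    simp only [← mul_fim_sub_mul_apply]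
    rw [← trace_transpose_mul_self, fluct_eq hS hU, ← hK]
    congr 1
    rw [Matrix.transpose_mul, Matrix.transpose_mul, transpose_fim_sub_flatFim, hKt]
    simp only [Matrix.mul_assoc]
    rw [← Matrix.mul_assoc Bᵀ, ← hB]
  have hV := mul_mem (dft_mem_unitaryGroup N) hU
  rw [quadTerm]
  simp only [← hK, h, Finset.expect_sum_comm, expect_powerFluct_sq hS hV]

/-- The phases of a delay response and of the amplitude responses of the same path cancel. -/
theorem star_steer_delay_mul (f : ℝ) (l : Fin L) (w : ℂ) :
    star (steer τ β f (Sum.inl l)) *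
      (w * Complex.exp (-(2 * Real.pi * Complex.I * f * τ l))) =
      ((2 * Real.pi * f : ℝ) : ℂ) * (star (β l) * (Complex.I * w)) := by
  have he : star (Complex.exp (-(2 * Real.pi * Complex.I * f * τ l))) *
      Complex.exp (-(2 * Real.pi * Complex.I * f * τ l)) = 1 := by
    rw [Complex.star_def, ← Complex.exp_conj, ← Complex.exp_add]
    simp [map_ofNat]
  have hs : star (steer τ β f (Sum.inl l)) = star (β l) * (2 * Real.pi * f * Complex.I) *
      star (Complex.exp (-(2 * Real.pi * Complex.I * f * τ l))) := by
    rw [steer, Sum.elim_inl, star_mul', star_mul']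
    congr 2
    simp
    ring
  rw [hs]
  push_cast
  linear_combination (star (β l) * (2 * Real.pi * f * Complex.I) * w) * he

theorem infoDensity_delay_re (f : ℝ) (l : Fin L) :
    infoDensity σ τ β f (Sum.inl l) (Sum.inr (Sum.inl l)) =
      4 * Real.pi / σ ^ 2 * (β l).im * f := by
  have h := star_steer_delay_mul (τ := τ) (β := β) f l 1
  rw [one_mul] at h
  rw [infoDensity, Matrix.of_apply, show steer τ β f (Sum.inr (Sum.inl l)) =
    Complex.exp (-(2 * Real.pi * Complex.I * f * τ l)) from rfl, h, Complex.re_ofReal_mul]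
  simp
  ring

theorem infoDensity_delay_im (f : ℝ) (l : Fin L) :
    infoDensity σ τ β f (Sum.inl l) (Sum.inr (Sum.inr l)) =
      -(4 * Real.pi / σ ^ 2 * (β l).re * f) := by
  rw [infoDensity, Matrix.of_apply, show steer τ β f (Sum.inr (Sum.inr l)) =
    Complex.I * Complex.exp (-(2 * Real.pi * Complex.I * f * τ l)) from rfl,
    star_steer_delay_mul, Complex.re_ofReal_mul, Complex.I_mul_I]
  simp
  ring

/-- The spread of the information density around its mean under a probability vector is at least
that of the frequency, since the couplings of a delay with its amplitude are linear in the
frequency. -/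
theorem le_sum_sq_infoDensity_sub (l : Fin L) (p : Fin N → ℝ) (n : Fin N) :
    (4 * Real.pi / σ ^ 2) ^ 2 * ‖β l‖ ^ 2 * (freq n - ∑ m, p m * freq m) ^ 2 ≤
      ∑ a, ∑ b, (infoDensity σ τ β (freq n) -
        ∑ m, p m • infoDensity σ τ β (freq m)) a b ^ 2 := by
  set D := infoDensity σ τ β (freq n) - ∑ m, p m • infoDensity σ τ β (freq m) with hD
  have h1 : D (Sum.inl l) (Sum.inr (Sum.inl l)) =
      4 * Real.pi / σ ^ 2 * (β l).im * (freq n - ∑ m, p m * freq m) := by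
    simp only [hD, Matrix.sub_apply, Matrix.sum_apply, Matrix.smul_apply, infoDensity_delay_re,
      smul_eq_mul, mul_sub, Finset.mul_sum]
    congr 1
    exact Finset.sum_congr rfl fun m _ => by ring
  have h2 : D (Sum.inl l) (Sum.inr (Sum.inr l)) =
      -(4 * Real.pi / σ ^ 2 * (β l).re * (freq n - ∑ m, p m * freq m)) := by
    simp only [hD, Matrix.sub_apply, Matrix.sum_apply, Matrix.smul_apply, infoDensity_delay_im,
      smul_eq_mul, mul_sub, Finset.mul_sum, mul_neg, Finset.sum_neg_distrib, neg_sub]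
    rw [neg_sub_neg]
    congr 1
    exact Finset.sum_congr rfl fun m _ => by ring
  calc _ = D (Sum.inl l) (Sum.inr (Sum.inl l)) ^ 2 + D (Sum.inl l) (Sum.inr (Sum.inr l)) ^ 2 := by
        rw [h1, h2, Complex.sq_norm, Complex.normSq_apply]; ring
    _ ≤ ∑ b, D (Sum.inl l) b ^ 2 := by
        have h := Finset.add_le_sum (f := fun b => D (Sum.inl l) b ^ 2) (s := Finset.univ)
          (fun _ _ => sq_nonneg _) (Finset.mem_univ (Sum.inr (Sum.inl l)))
          (Finset.mem_univ (Sum.inr (Sum.inr l))) (by simp)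
        exact h
    _ ≤ _ := Finset.single_le_sum (f := fun a => ∑ b, D a b ^ 2)
        (fun _ _ => Finset.sum_nonneg fun _ _ => sq_nonneg _) (Finset.mem_univ _)

theorem sq_rmsBandwidth (u : Fin N → ℂ) :
    rmsBandwidth u ^ 2 = ∑ k, powerSpectrum u k * (freq k - centroid u) ^ 2 := by
  have h : 0 ≤ ∑ k, |freq k - centroid u| ^ 2 * powerSpectrum u k :=
    Finset.sum_nonneg fun k _ => mul_nonneg (sq_nonneg _) (sq_nonneg _)
  rw [rmsBandwidth, Real.sq_sqrt h]
  exact Finset.sum_congr rfl fun k _ => by rw [sq_abs, mul_comm]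

/-- If the inverse of the mean information matrix dominates `k`, the quadratic term of an
`α`-frequency-spread waveform exceeds that of OFDM by a constant times `k³ N α²`. As `k` has order
`1 / N`, this is of order `1 / N²`. -/
theorem le_quadTerm_sub_quadTerm_ofdm (hS : IsSubGaussianConstellation S)
    {U : Matrix (Fin N) (Fin N) ℂ} (hU : U ∈ Matrix.unitaryGroup (Fin N) ℂ)
    (hpd : (flatFim σ τ β N).PosDef) {k : ℝ} (hk : 0 ≤ k)
    (hlow : ∀ x, k * (x ⬝ᵥ x) ≤ x ⬝ᵥ (flatFim σ τ β N)⁻¹ *ᵥ x) {α : ℝ} (hα : 0 ≤ α)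
    (hspread : IsFreqSpread α U) (l : Fin L) :
    (2 - kurtosis S) * (k ^ 3 * ((4 * Real.pi / σ ^ 2) ^ 2 * ‖β l‖ ^ 2 * (N * α ^ 2))) ≤
      quadTerm S σ τ β U - quadTerm S σ τ β (ofdm N) := by
  have hκ : 0 < 2 - kurtosis S := by linarith [hS.kurtosis_lt]
  obtain ⟨B, hB⟩ := exists_eq_transpose_mul_self hpd.inv
  set K := (flatFim σ τ β N)⁻¹ with hK
  set V := dft N * U with hVdef
  have hV : V ∈ Matrix.unitaryGroup (Fin N) ℂ := mul_mem (dft_mem_unitaryGroup N) hU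
  set g : ParamIdx L → ParamIdx L → Fin N → ℝ := fun a b n =>
    (B * infoDensity σ τ β (freq n) * K) a b with hg
  -- For OFDM every column spectrum is a point mass, so that all variances vanish.
  have hofdm : ∀ h : Fin N → ℝ, ∑ j, (∑ n, ‖(dft N * ofdm N) n j‖ ^ 2 * h n) ^ 2 =
      ∑ n, h n ^ 2 := by
    intro h
    rw [dft_mul_ofdm]
    refine Finset.sum_congr rfl fun j _ => ?_
    rw [Finset.sum_eq_single j (fun n _ hn => by simp [Matrix.one_apply_ne hn]) (by simp)]
    simp
  have hdiff : quadTerm S σ τ β U - quadTerm S σ τ β (ofdm N) =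
      (2 - kurtosis S) * ∑ a, ∑ b, ∑ j, ∑ n, ‖V n j‖ ^ 2 *
        (g a b n - ∑ m, ‖V m j‖ ^ 2 * g a b m) ^ 2 := by
    rw [quadTerm_eq hS hU hB, quadTerm_eq hS (ofdm_mem_unitaryGroup N) hB,
      ← Finset.sum_sub_distrib, Finset.mul_sum]
    refine Finset.sum_congr rfl fun a _ => ?_
    rw [← Finset.sum_sub_distrib, Finset.mul_sum]
    refine Finset.sum_congr rfl fun b _ => ?_
    rw [hofdm, ← sum_sq_sub_eq_sum_variance hV]
    ring
  rw [hdiff]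
  refine mul_le_mul_of_nonneg_left ?_ hκ.le
  have hswap : ∑ a, ∑ b, ∑ j, ∑ n, ‖V n j‖ ^ 2 * (g a b n - ∑ m, ‖V m j‖ ^ 2 * g a b m) ^ 2 =
      ∑ j, ∑ n, ‖V n j‖ ^ 2 *
        ∑ a, ∑ b, (g a b n - ∑ m, ‖V m j‖ ^ 2 * g a b m) ^ 2 := by
    simp only [Finset.mul_sum]
    calc _ = ∑ a, ∑ j, ∑ b, ∑ n, ‖V n j‖ ^ 2 * (g a b n - ∑ m, ‖V m j‖ ^ 2 * g a b m) ^ 2 :=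
          Finset.sum_congr rfl fun a _ => Finset.sum_comm
      _ = ∑ j, ∑ a, ∑ b, ∑ n, ‖V n j‖ ^ 2 * (g a b n - ∑ m, ‖V m j‖ ^ 2 * g a b m) ^ 2 :=
          Finset.sum_comm
      _ = ∑ j, ∑ a, ∑ n, ∑ b, ‖V n j‖ ^ 2 * (g a b n - ∑ m, ‖V m j‖ ^ 2 * g a b m) ^ 2 :=
          Finset.sum_congr rfl fun j _ => Finset.sum_congr rfl fun a _ => Finset.sum_comm
      _ = _ := Finset.sum_congr rfl fun j _ => Finset.sum_comm
  rw [hswap]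
  -- Each column contributes at least its squared bandwidth.
  have hcol : ∀ j : Fin N, k ^ 3 * ((4 * Real.pi / σ ^ 2) ^ 2 * ‖β l‖ ^ 2 * α ^ 2) ≤
      ∑ n, ‖V n j‖ ^ 2 * ∑ a, ∑ b, (g a b n - ∑ m, ‖V m j‖ ^ 2 * g a b m) ^ 2 := by
    intro j
    have hterm : ∀ n, k ^ 3 * ((4 * Real.pi / σ ^ 2) ^ 2 * ‖β l‖ ^ 2 *
        (freq n - ∑ m, ‖V m j‖ ^ 2 * freq m) ^ 2) ≤
        ∑ a, ∑ b, (g a b n - ∑ m, ‖V m j‖ ^ 2 * g a b m) ^ 2 := by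
      intro n
      set D := infoDensity σ τ β (freq n) -
        ∑ m, ‖V m j‖ ^ 2 • infoDensity σ τ β (freq m) with hD
      have hDt : Dᵀ = D := by
        rw [hD, Matrix.transpose_sub, transpose_infoDensity, Matrix.transpose_sum]
        simp only [Matrix.transpose_smul, transpose_infoDensity]
      have hent : ∀ a b, g a b n - ∑ m, ‖V m j‖ ^ 2 * g a b m = (B * D * K) a b := by
        intro a b
        simp only [hD, hg, mul_sub, sub_mul, Matrix.mul_sum, Matrix.sum_mul, Matrix.sub_apply,
          Matrix.sum_apply, Matrix.mul_smul, Matrix.smul_mul, Matrix.smul_apply, smul_eq_mul]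
      simp only [hent]
      refine le_trans ?_ (pow_three_mul_sum_sq_le hk hB hDt hlow)
      exact mul_le_mul_of_nonneg_left (le_sum_sq_infoDensity_sub l _ n) (by positivity)
    have hband : α ^ 2 ≤ ∑ n, ‖V n j‖ ^ 2 * (freq n - ∑ m, ‖V m j‖ ^ 2 * freq m) ^ 2 := by
      have h1 := pow_le_pow_left₀ hα (hspread j) 2
      rw [sq_rmsBandwidth] at h1
      have h2 : ∀ n, powerSpectrum (fun m => U m j) n = ‖V n j‖ ^ 2 := fun n => rfl
      simp only [centroid, h2, mul_comm (freq _)] at h1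
      exact h1
    calc _ ≤ k ^ 3 * ((4 * Real.pi / σ ^ 2) ^ 2 * ‖β l‖ ^ 2 *
          ∑ n, ‖V n j‖ ^ 2 * (freq n - ∑ m, ‖V m j‖ ^ 2 * freq m) ^ 2) := by gcongr
      _ = ∑ n, ‖V n j‖ ^ 2 * (k ^ 3 * ((4 * Real.pi / σ ^ 2) ^ 2 * ‖β l‖ ^ 2 *
          (freq n - ∑ m, ‖V m j‖ ^ 2 * freq m) ^ 2)) := by
          rw [Finset.mul_sum, Finset.mul_sum]
          exact Finset.sum_congr rfl fun n _ => by ring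
      _ ≤ _ := Finset.sum_le_sum fun n _ =>
          mul_le_mul_of_nonneg_left (hterm n) (by positivity)
  refine le_trans (le_of_eq ?_) (Finset.sum_le_sum fun j _ => hcol j)
  simp only [Finset.sum_const, Finset.card_univ, Fintype.card_fin, nsmul_eq_mul]
  ring

end Gap

end ISAC

end

theorem corollary3
    (S : Finset ℂ) (hS : ISAC.IsSubGaussianConstellation S)
    (σ : ℝ) (hσ : 0 < σ)
    (L : ℕ) (hL : 0 < L)
    (τ : Fin L → ℝ) (hτ : ∀ k l, k ≠ l → τ k ≠ τ l)
    (β : Fin L → ℂ) (hβ : ∀ l, β l ≠ 0)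
    (ρ : ℝ) (hρ0 : 0 < ρ) (hρ1 : ρ < 1)
    (α : ℝ) (hα : 0 < α)
    (U : ∀ N : ℕ, Matrix (Fin N) (Fin N) ℂ)
    (hU : ∀ N, U N ∈ Matrix.unitaryGroup (Fin N) ℂ)
    (hspread : ∀ᶠ N in atTop, ISAC.IsFreqSpread α (U N)) :
    ∃ c : ℝ, 0 < c ∧ ∃ N₀ : ℕ, ∀ N : ℕ, N₀ ≤ N →
      -- both conditional expectations are meaningful
      (0 < ISAC.symbolVecLaw S N (ISAC.goodEvent S σ ρ τ β (U N)) ∧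
        0 < ISAC.symbolVecLaw S N (ISAC.goodEvent S σ ρ τ β (ISAC.ofdm N)) ∧
        (∀ s ∈ ISAC.goodEvent S σ ρ τ β (U N), IsUnit (ISAC.fim σ τ β (U N) s)) ∧
        (∀ s ∈ ISAC.goodEvent S σ ρ τ β (ISAC.ofdm N),
          IsUnit (ISAC.fim σ τ β (ISAC.ofdm N) s))) ∧
      -- the gap is at least of order `N⁻²`, and in particular positive
      c / (N : ℝ) ^ 2 ≤
        ISAC.condFullCRB S σ ρ τ β (U N) - ISAC.condFullCRB S σ ρ τ β (ISAC.ofdm N) ∧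
      ISAC.condFullCRB S σ ρ τ β (ISAC.ofdm N) < ISAC.condFullCRB S σ ρ τ β (U N) := by
  have hτ' : Function.Injective τ := fun k l h => by
    by_contra hkl
    exact hτ k l hkl h
  obtain ⟨A, hA, hexp⟩ := ISAC.exists_condFullCRB_expansion hS hσ hτ' hβ hρ0 hρ1
  obtain ⟨k, _, hk, _, hK⟩ := ISAC.exists_flatFim_inv_bounds hσ hτ' hβ
  have hκ : 0 < 2 - ISAC.kurtosis S := by linarith [hS.kurtosis_lt]
  have hβ0 : 0 < ‖β ⟨0, hL⟩‖ := norm_pos_iff.2 (hβ _)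
  set c₀ : ℝ := (2 - ISAC.kurtosis S) *
    (k ^ 3 * ((4 * Real.pi / σ ^ 2) ^ 2 * ‖β ⟨0, hL⟩‖ ^ 2 * α ^ 2)) with hc₀
  have hc₀pos : 0 < c₀ := by
    have := Real.pi_pos
    positivity
  refine ⟨c₀ / 2, by positivity, ?_⟩
  have hsqrt : Tendsto (fun N : ℕ => Real.sqrt N) atTop atTop :=
    Real.tendsto_sqrt_atTop.comp tendsto_natCast_atTop_atTop
  rw [← eventually_atTop]
  filter_upwards [hexp, hK, hspread, hsqrt.eventually_ge_atTop (4 * A / c₀)]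
    with N hN hKN hsp hNA
  obtain ⟨hN0, hpd, -, hlow⟩ := hKN
  have hNpos : (0 : ℝ) < N := by exact_mod_cast hN0
  have hsN : 0 < Real.sqrt N := Real.sqrt_pos.2 hNpos
  obtain ⟨hp1, hu1, he1⟩ := hN _ (hU N)
  obtain ⟨hp2, hu2, he2⟩ := hN _ (ISAC.ofdm_mem_unitaryGroup N)
  have hgap := ISAC.le_quadTerm_sub_quadTerm_ofdm hS (hU N) hpd (by positivity) hlow hα.le hsp
    ⟨0, hL⟩
  have hc : (2 - ISAC.kurtosis S) * ((k / N) ^ 3 * ((4 * Real.pi / σ ^ 2) ^ 2 *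
      ‖β ⟨0, hL⟩‖ ^ 2 * (N * α ^ 2))) = c₀ / N ^ 2 := by
    rw [hc₀]
    field_simp
  rw [hc] at hgap
  have herr : A / (N ^ 2 * Real.sqrt N) ≤ c₀ / 4 / N ^ 2 := by
    rw [mul_comm ((N : ℝ) ^ 2), ← div_div]
    refine div_le_div_of_nonneg_right ?_ (by positivity)
    rw [div_le_iff₀ hsN]
    rw [div_le_iff₀ hc₀pos] at hNA
    linarith
  have h1 := (abs_le.1 he1).1
  have h2 := (abs_le.1 he2).2
  have hsplit : c₀ / N ^ 2 = c₀ / 2 / N ^ 2 + 2 * (c₀ / 4 / N ^ 2) := by ring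
  have hmain : c₀ / 2 / (N : ℝ) ^ 2 ≤ ISAC.condFullCRB S σ ρ τ β (U N) -
      ISAC.condFullCRB S σ ρ τ β (ISAC.ofdm N) := by linarith
  refine ⟨⟨hp1, hp2, hu1, hu2⟩, hmain, ?_⟩
  have : 0 < c₀ / 2 / (N : ℝ) ^ 2 := by positivity
  linarith
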